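/- Let $\Lambda\subset\mathbb R^2$ be the lattice generated by two linearly independent vectors $l_1,l_2$, let $Y=\{c_1l_1+c_2l_2 : c_1,c_2\in[0,1]\}$ be its unit cell, and let $\Lambda^*=\{q\in\mathbb R^2 : q\cdot\ell\in2\pi\mathbb Z \text{ for all } \ell\in\Lambda\}$ be the reciprocal lattice. Let $0<s<1$ and let $D=\bigcup_{i=1}^N D_i$, where $D_1,\dots,D_N\subset Y$ are disjoint connected open sets with boundaries of class $C^{1,s}$. Let $\alpha,\beta\in\mathbb R^2$ and $k\in\mathbb R$ be such that $$k^2+|\beta|^2-2\mathrm i\,\beta\cdot(\alpha+q)-|\alpha+q|^2\neq 0\qquad\text{for all } q\in\Lambda^*,$$ so that the band gap Green's function $$\tilde G^{\alpha,\beta,k}(x)=\frac1{|Y|}\sum_{q\in\Lambda^*}\frac{e^{\mathrm i(\alpha+q)\cdot x}}{k^2+|\beta|^2-2\mathrm i\,\beta\cdot(\alpha+q)-|\alpha+q|^2}\qquad(x\notin\Lambda)$$ is defined (the series converges conditionally; it is understood as the limit of the partial sums over $q=mb_1+nb_2$ with integers $|m|,|n|\le M$, as $M\to\infty$, where $b_i\cdot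 l_j=2\pi\delta_{ij}$). For $\phi\in L^2(\partial D)$ let $$\tilde{\mathcal S}_D^{\alpha,\beta,k}[\phi](x)=\int_{\partial D}\tilde G^{\alpha,\beta,k}(x-y)\,\phi(y)\,\mathrm d\sigma(y),\qquad x\in\mathbb R^2,$$ where $\sigma$ is arc length. Assume that $k=0$ or, more generally, that $k^2$ is not an eigenvalue of the Dirichlet Laplacian $-\Delta$ in $D$. Suppose that $\tilde{\mathcal S}_D^{\alpha,\beta,k}$ has a non-trivial kernel function $\phi$, that is, $\phi\in L^2(\partial D)$, $\phi\ne0$ and $\tilde{\mathcal S}_D^{\alpha,\beta,k}[\phi]=0$ on $\partial D$ ($\sigma$-almost everywhere). Then $v=\tilde{\mathcal S}_D^{\alpha,\beta,k}[\phi]$ satisfies $v(x)=0$ for all $x\in D$. -/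

import Mathlib

open MeasureTheory Filter Topology Set
open scoped NNReal InnerProductSpace

noncomputable section

/-- The Euclidean plane. -/
abbrev Plane : Type := EuclideanSpace ℝ (Fin 2)

/-! ### Lattice, unit cell, reciprocal lattice -/

/-- The lattice of all integer linear combinations of the lattice vectors `l 0`, `l 1`. -/
def lattice (l : Module.Basis (Fin 2) ℝ Plane) : Submodule ℤ Plane :=
  Submodule.span ℤ (Set.range l)

/-- The unit cell: all combinations of `l 0`, `l 1` with coefficients in `[0, 1]`. -/
def unitCell (l : Module.Basis (Fin 2) ℝ Plane) : Set Plane :=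
  parallelepiped l

/-- The reciprocal lattice: all `q` such that `q · ℓ ∈ 2πℤ` for all lattice points `ℓ`. -/
def reciprocalLattice (l : Module.Basis (Fin 2) ℝ Plane) : Set Plane :=
  {q | ∀ ℓ ∈ lattice l, ∃ n : ℤ, ⟪q, ℓ⟫_ℝ = 2 * Real.pi * n}

/-- The vectors `b 0`, `b 1` determined by `b i · l j = 2π δ_{ij}`. -/
def reciprocalVector (l : Module.Basis (Fin 2) ℝ Plane) (i : Fin 2) : Plane :=
  (2 * Real.pi) •
    (InnerProductSpace.toDual ℝ Plane).symm (LinearMap.toContinuousLinearMap (l.coord i))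

/-- The point `m b₀ + n b₁` of the reciprocal lattice. -/
def reciprocalPoint (l : Module.Basis (Fin 2) ℝ Plane) (m n : ℤ) : Plane :=
  (m : ℝ) • reciprocalVector l 0 + (n : ℝ) • reciprocalVector l 1

theorem inner_reciprocalVector (l : Module.Basis (Fin 2) ℝ Plane) (i : Fin 2) (x : Plane) :
    ⟪reciprocalVector l i, x⟫_ℝ = 2 * Real.pi * l.repr x i := by
  simp [reciprocalVector, inner_smul_left]

theorem inner_reciprocalPoint (l : Module.Basis (Fin 2) ℝ Plane) (m n : ℤ) (x : Plane) :
    ⟪reciprocalPoint l m n, x⟫_ℝ = 2 * Real.pi * (m * l.repr x 0 + n * l.repr x 1) := by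
  simp only [reciprocalPoint, inner_add_left, inner_smul_left, inner_reciprocalVector]
  simp
  ring

/-- The points `m b₀ + n b₁` are exactly the points of the reciprocal lattice. -/
theorem mem_reciprocalLattice_iff (l : Module.Basis (Fin 2) ℝ Plane) (q : Plane) :
    q ∈ reciprocalLattice l ↔ ∃ m n : ℤ, q = reciprocalPoint l m n := by
  constructor
  · intro h
    obtain ⟨m, hm⟩ := h (l 0) (Submodule.subset_span ⟨0, rfl⟩)
    obtain ⟨n, hn⟩ := h (l 1) (Submodule.subset_span ⟨1, rfl⟩)
    refine ⟨m, n, ?_⟩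
    refine InnerProductSpace.ext_inner_right_basis l fun i => ?_
    fin_cases i
    · simpa [inner_reciprocalPoint] using hm
    · simpa [inner_reciprocalPoint] using hn
  · rintro ⟨m, n, rfl⟩ ℓ hℓ
    have hi : ∀ i : Fin 2, ∃ c : ℤ, l.repr ℓ i = c := by
      intro i
      induction hℓ using Submodule.span_induction with
      | mem x hx =>
        obtain ⟨j, rfl⟩ := hx
        by_cases hij : j = i
        · exact ⟨1, by simp [hij]⟩
        · exact ⟨0, by simp [hij]⟩
      | zero => exact ⟨0, by simp⟩
      | add x y _ _ hx hy =>
        obtain ⟨a, ha⟩ := hx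
        obtain ⟨b, hb⟩ := hy
        exact ⟨a + b, by simp [ha, hb]⟩
      | smul c x _ hx =>
        obtain ⟨a, ha⟩ := hx
        exact ⟨c * a, by
          rw [← Int.cast_smul_eq_zsmul ℝ c x, map_smul]
          simp [ha]⟩
    obtain ⟨a, ha⟩ := hi 0
    obtain ⟨b, hb⟩ := hi 1
    exact ⟨m * a + n * b, by rw [inner_reciprocalPoint, ha, hb]; push_cast; ring⟩

/-! ### Resonators -/

/-- The open set `Ω` has a boundary of class `C^{1,s}`: near each boundary point and in suitable
Cartesian coordinates, `Ω` is the part of the plane above the graph of a function whose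
derivative is Hölder continuous of exponent `s`. -/
def HasC1HolderBoundary (s : ℝ≥0) (Ω : Set Plane) : Prop :=
  ∀ p ∈ frontier Ω, ∃ (T : Plane ≃ᵢ Plane) (g : ℝ → ℝ) (C : ℝ≥0),
    ContDiff ℝ 1 g ∧ HolderWith C s (deriv g) ∧
      ∀ᶠ y in 𝓝 p, (y ∈ Ω ↔ g (T y 0) < T y 1)

/-- A finite family of resonators in the unit cell: disjoint, connected open sets with boundaries
of class `C^{1,s}`. -/
structure IsResonatorFamily (l : Module.Basis (Fin 2) ℝ Plane) (s : ℝ≥0) {N : ℕ}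
    (R : Fin N → Set Plane) : Prop where
  isOpen : ∀ i, IsOpen (R i)
  isConnected : ∀ i, IsConnected (R i)
  subset_unitCell : ∀ i, R i ⊆ unitCell l
  boundary : ∀ i, HasC1HolderBoundary s (R i)
  disjoint : Pairwise fun i j => Disjoint (R i) (R j)

/-- The arc length measure `σ` on the boundary of `D`. -/
def boundaryMeasure (D : Set Plane) : Measure Plane :=
  (Measure.hausdorffMeasure 1).restrict (frontier D)

/-! ### Band gap Green's function and single layer potential -/

/-- The denominator `k² + |β|² - 2 i β · ξ - |ξ|²` of the band gap Green's function, at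
`ξ = α + q`. -/
def bandGapSymbol (β : Plane) (k : ℝ) (ξ : Plane) : ℂ :=
  (k : ℂ) ^ 2 + (‖β‖ : ℂ) ^ 2 - 2 * Complex.I * (⟪β, ξ⟫_ℝ : ℂ) - (‖ξ‖ : ℂ) ^ 2

/-- The partial sum of the series of the band gap Green's function over the reciprocal lattice
points `m b₀ + n b₁` with `|m|, |n| ≤ M`. -/
def bandGapGreenPartialSum (l : Module.Basis (Fin 2) ℝ Plane) (α β : Plane) (k : ℝ) (M : ℕ)
    (x : Plane) : ℂ :=
  ((volume.real (unitCell l) : ℝ) : ℂ)⁻¹ *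
    ∑ m ∈ Finset.Icc (-(M : ℤ)) M, ∑ n ∈ Finset.Icc (-(M : ℤ)) M,
      Complex.exp (Complex.I * (⟪α + reciprocalPoint l m n, x⟫_ℝ : ℂ)) /
        bandGapSymbol β k (α + reciprocalPoint l m n)

/-- The band gap Green's function
`|Y|⁻¹ ∑_q exp(i (α + q) · x) / (k² + |β|² - 2 i β · (α + q) - |α + q|²)`, `q` running over the
reciprocal lattice. The series is only conditionally convergent; it is summed as the limit of its
square partial sums. These converge at every `x` outside the lattice (summation by parts) as soon
as no denominator vanishes. -/
def bandGapGreen (l : Module.Basis (Fin 2) ℝ Plane) (α β : Plane) (k : ℝ) (x : Plane) : ℂ :=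
  limUnder atTop fun M : ℕ => bandGapGreenPartialSum l α β k M x

/-- The band gap single layer potential `∫_{∂D} G(x - y) φ(y) dσ(y)`, as a function on the
plane. -/
def singleLayer (l : Module.Basis (Fin 2) ℝ Plane) (α β : Plane) (k : ℝ) (D : Set Plane)
    (φ : Lp ℂ 2 (boundaryMeasure D)) (x : Plane) : ℂ :=
  ∫ y, bandGapGreen l α β k (x - y) * φ y ∂(boundaryMeasure D)

/-- `φ ∈ L²(∂D)` is a non-trivial kernel function of the single layer potential, as an operator
into functions on `∂D`. -/
def IsNontrivialKernelFunction (l : Module.Basis (Fin 2) ℝ Plane) (α β : Plane) (k : ℝ)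
    (D : Set Plane) (φ : Lp ℂ 2 (boundaryMeasure D)) : Prop :=
  φ ≠ 0 ∧ ∀ᵐ x ∂(boundaryMeasure D), singleLayer l α β k D φ x = 0

/-- `μ` is an eigenvalue of the Dirichlet Laplacian `-Δ` in the open set `D`. -/
def IsDirichletEigenvalue (D : Set Plane) (μ : ℝ) : Prop :=
  ∃ w : Plane → ℂ, ContDiffOn ℝ 2 w D ∧ ContinuousOn w (closure D) ∧
    (∀ x ∈ D, Laplacian.laplacian w x + (μ : ℂ) * w x = 0) ∧
    (∀ x ∈ frontier D, w x = 0) ∧ ∃ x ∈ D, w x ≠ 0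

end

/-! Put ξ = α + q. Since ∑ⱼ (iξⱼ - βⱼ)² + k² is exactly the denominator in the Green's function
(`sum_sq_eq_bandGapSymbol`), Δ + k² applied termwise to exp(-β·x) G̃(x) cancels every denominator
and leaves, formally, a distribution supported on the lattice. Hence w = exp(-β·x) v solves Δw + k²w
= 0 in D. If v is continuous on the closure of D and zero on its boundary, then w is a Dirichlet
solution: it vanishes by the maximum principle when k = 0, and because k² is not an eigenvalue
otherwise. The exponential has no zeros, so v = 0 in D.

The work lies in justifying this for a conditionally convergent series. Multiplying by 1 - exp(i
bⱼ·x) takes a backward difference of the coefficients, and each of the first three differences gains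
one order of decay, from 2 up to 5. Three of them make the series C², so G̃ is C² off the lattice.
The Helmholtz equation is then read off the series multiplied by the 3rd, 4th and 5th powers of this
factor: E⁻ⁿ Δ(Eⁿ H) is quadratic in n, so three values determine the one at n = 0
(`laplacian_extrapolation`), and the same combination of coefficients vanishes
(`backDiff_extrapolation`).

A single difference also gives G̃ = O(|x - ℓ|^(-1/4)) at lattice points ℓ
(`exists_norm_bandGapGreen_le`). This is weaker than the true logarithm, but its cube is integrable
along the boundary, uniformly in x. A kernel bounded in L³ against an L² density gives a continuous
potential (`continuousOn_potential`). Since every piece of the boundary near a boundary point has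
positive length, vanishing almost everywhere becomes vanishing everywhere on ∂D. -/

noncomputable section

/-! ### Backward differences of lattice sequences -/

/-- The weight `1 + ‖p‖` on `ℤ × ℤ`. -/
def latticeWeight (p : ℤ × ℤ) : ℝ := 1 + ‖p‖

theorem one_le_latticeWeight (p : ℤ × ℤ) : 1 ≤ latticeWeight p := by
  simp [latticeWeight]

theorem latticeWeight_pos (p : ℤ × ℤ) : 0 < latticeWeight p :=
  one_pos.trans_le (one_le_latticeWeight p)

theorem latticeWeight_le_mul (p e : ℤ × ℤ) :
    latticeWeight p ≤ latticeWeight e * latticeWeight (p - e) := by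
  have h : ‖p‖ ≤ ‖e‖ + ‖p - e‖ := by simpa using norm_add_le e (p - e)
  unfold latticeWeight
  nlinarith [norm_nonneg e, norm_nonneg (p - e)]

theorem latticeWeight_sub_le_mul (p e : ℤ × ℤ) :
    latticeWeight (p - e) ≤ latticeWeight e * latticeWeight p := by
  have h : ‖p - e‖ ≤ ‖p‖ + ‖e‖ := norm_sub_le p e
  unfold latticeWeight
  nlinarith [norm_nonneg e, norm_nonneg p]

/-- The sequence `c` is `O((1 + ‖p‖) ^ (-r))`. -/
def HasDecay (c : ℤ × ℤ → ℂ) (r : ℝ) : Prop :=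
  ∃ C : ℝ, ∀ p, ‖c p‖ ≤ C * latticeWeight p ^ (-r)

namespace HasDecay

variable {c d : ℤ × ℤ → ℂ} {r t : ℝ}

theorem exists_pos (h : HasDecay c r) :
    ∃ C : ℝ, 0 < C ∧ ∀ p, ‖c p‖ ≤ C * latticeWeight p ^ (-r) := by
  obtain ⟨C, hC⟩ := h
  refine ⟨max C 1, by positivity, fun p => (hC p).trans ?_⟩
  have := Real.rpow_nonneg (latticeWeight_pos p).le (-r)
  gcongr
  exact le_max_left _ _

theorem mono (h : HasDecay c r) (ht : t ≤ r) : HasDecay c t := by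
  obtain ⟨C, hC0, hC⟩ := h.exists_pos
  refine ⟨C, fun p => (hC p).trans ?_⟩
  gcongr
  exact one_le_latticeWeight p

theorem add (h : HasDecay c r) (h' : HasDecay d r) : HasDecay (fun p => c p + d p) r := by
  obtain ⟨C, hC⟩ := h
  obtain ⟨C', hC'⟩ := h'
  refine ⟨C + C', fun p => (norm_add_le _ _).trans ?_⟩
  rw [add_mul]
  exact add_le_add (hC p) (hC' p)

theorem neg (h : HasDecay c r) : HasDecay (fun p => -c p) r := by
  simpa [HasDecay] using h

theorem sub (h : HasDecay c r) (h' : HasDecay d r) : HasDecay (fun p => c p - d p) r := by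
  simpa [sub_eq_add_neg] using h.add h'.neg

theorem mul (h : HasDecay c r) (h' : HasDecay d t) :
    HasDecay (fun p => c p * d p) (r + t) := by
  obtain ⟨C, hC0, hC⟩ := h.exists_pos
  obtain ⟨C', hC0', hC'⟩ := h'.exists_pos
  refine ⟨C * C', fun p => ?_⟩
  have hw := latticeWeight_pos p
  rw [norm_mul, neg_add, Real.rpow_add hw]
  calc ‖c p‖ * ‖d p‖ ≤ (C * latticeWeight p ^ (-r)) * (C' * latticeWeight p ^ (-t)) := by
        gcongr
        exacts [hC p, hC' p]
    _ = _ := by ring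

theorem const_mul (h : HasDecay c r) (z : ℂ) : HasDecay (fun p => z * c p) r := by
  obtain ⟨C, hC⟩ := h
  refine ⟨‖z‖ * C, fun p => ?_⟩
  rw [norm_mul, mul_assoc]
  gcongr
  exact hC p

/-- The weights at p and p - e differ by at most the factor `latticeWeight e` in either direction.
Negative r must be allowed, since the symbol and its first difference grow. -/
theorem shift (h : HasDecay c r) (e : ℤ × ℤ) : HasDecay (fun p => c (p - e)) r := by
  obtain ⟨C, hC0, hC⟩ := h.exists_pos
  refine ⟨C * latticeWeight e ^ |r|, fun p => (hC _).trans ?_⟩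
  have hw := latticeWeight_pos p
  have hw' := latticeWeight_pos (p - e)
  have he := latticeWeight_pos e
  rw [mul_assoc]
  gcongr
  rcases le_total 0 r with hr | hr
  · rw [abs_of_nonneg hr]
    have h1 : latticeWeight p ^ r ≤ latticeWeight e ^ r * latticeWeight (p - e) ^ r := by
      rw [← Real.mul_rpow he.le hw'.le]
      exact Real.rpow_le_rpow hw.le (latticeWeight_le_mul p e) hr
    rw [Real.rpow_neg hw.le, Real.rpow_neg hw'.le, ← div_eq_mul_inv,
      inv_le_iff_one_le_mul₀ (by positivity), div_mul_eq_mul_div, le_div_iff₀ (by positivity)]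
    simpa using h1
  · rw [abs_of_nonpos hr, ← Real.mul_rpow he.le hw.le]
    exact Real.rpow_le_rpow hw'.le (latticeWeight_sub_le_mul p e) (by linarith)

theorem mul_bounded {f : ℤ × ℤ → ℂ} {B : ℝ} (h : HasDecay c r) (hf : ∀ p, ‖f p‖ ≤ B) :
    HasDecay (fun p => c p * f p) r := by
  obtain ⟨C, hC0, hC⟩ := h.exists_pos
  refine ⟨C * B, fun p => ?_⟩
  have := Real.rpow_nonneg (latticeWeight_pos p).le (-r)
  rw [norm_mul]
  calc ‖c p‖ * ‖f p‖ ≤ (C * latticeWeight p ^ (-r)) * B := by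
        gcongr
        exacts [hC p, hf p]
    _ = _ := by ring

end HasDecay

theorem summable_latticeWeight_rpow {r : ℝ} (hr : 2 < r) :
    Summable fun p : ℤ × ℤ => latticeWeight p ^ (-r) := by
  have h := EisensteinSeries.summable_one_div_norm_rpow hr
  have h' : Summable fun p : ℤ × ℤ => ‖p‖ ^ (-r) := by
    rw [← (finTwoArrowEquiv ℤ).summable_iff]
    refine h.congr fun x => ?_
    have : ‖(finTwoArrowEquiv ℤ) x‖ = ‖x‖ := by
      simp [Prod.norm_def, EisensteinSeries.norm_eq_max_natAbs, Int.norm_eq_abs]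
    rw [Function.comp_apply, this]
  refine h'.of_norm_bounded_eventually ?_
  -- At the origin `‖p‖ ^ (-r)` has the default value 0 while the weight is 1, so the comparison is
  -- made off that point.
  filter_upwards [(Set.finite_singleton (0 : ℤ × ℤ)).compl_mem_cofinite] with p hp
  have hp' : 0 < ‖p‖ := norm_pos_iff.2 hp
  rw [Real.norm_of_nonneg (Real.rpow_nonneg (latticeWeight_pos p).le _)]
  exact Real.rpow_le_rpow_of_nonpos hp' (by simp [latticeWeight]) (by linarith)

theorem HasDecay.summable_norm {c : ℤ × ℤ → ℂ} {r : ℝ} (h : HasDecay c r) (hr : 2 < r) :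
    Summable fun p => ‖c p‖ := by
  obtain ⟨C, hC⟩ := h
  exact Summable.of_nonneg_of_le (fun _ => norm_nonneg _) hC
    ((summable_latticeWeight_rpow hr).mul_left C)

theorem HasDecay.summable {c : ℤ × ℤ → ℂ} {r : ℝ} (h : HasDecay c r) (hr : 2 < r) :
    Summable c := (h.summable_norm hr).of_norm

/-- The backward difference of a lattice sequence in the direction `e`. -/
def backDiff (e : ℤ × ℤ) (c : ℤ × ℤ → ℂ) : ℤ × ℤ → ℂ := fun p => c p - c (p - e)

theorem HasDecay.backDiff_self {c : ℤ × ℤ → ℂ} {r : ℝ} (h : HasDecay c r) (e : ℤ × ℤ) :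
    HasDecay (backDiff e c) r := h.sub (h.shift e)

/-! ### Discrete quotient rules for a = 1/b -/

section Reciprocal

variable {e : ℤ × ℤ} {a b : ℤ × ℤ → ℂ}

/-- All differences of b·a = 1 vanish. The discrete Leibniz rule, with terms ∇ʲb(p) ∇ⁿ⁻ʲa(p - je),
is solved for ∇ⁿa after multiplication by a; this is n = 1, and the next two lemmas are n = 2, 3. -/
theorem backDiff_of_mul_eq_one (hab : ∀ p, b p * a p = 1) (p : ℤ × ℤ) :
    backDiff e a p = a p * (-(backDiff e b p) * a (p - e)) := by
  simp only [backDiff]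
  linear_combination (-a p) * hab (p - e) + a (p - e) * hab p

theorem backDiff_two_of_mul_eq_one (hab : ∀ p, b p * a p = 1) (p : ℤ × ℤ) :
    backDiff e (backDiff e a) p = a p * (-2 * (backDiff e b p * backDiff e a (p - e))
      - backDiff e (backDiff e b) p * a (p - e - e)) := by
  simp only [backDiff]
  linear_combination (-(a p - a (p - e) - (a (p - e) - a (p - e - e)))) * hab p + a p * (hab p
    - 2 * hab (p - e) + hab (p - e - e))

theorem backDiff_three_of_mul_eq_one (hab : ∀ p, b p * a p = 1)
    (hb : ∀ p, backDiff e (backDiff e (backDiff e b)) p = 0) (p : ℤ × ℤ) :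
    backDiff e (backDiff e (backDiff e a)) p =
      a p * (-3 * (backDiff e b p * backDiff e (backDiff e a) (p - e))
        - 3 * (backDiff e (backDiff e b) p * backDiff e a (p - e - e))) := by
  have h := hb p
  simp only [backDiff] at h ⊢
  linear_combination (-(a p - 3 * a (p - e) + 3 * a (p - e - e) - a (p - e - e - e))) * hab p
    + a p * (hab p - 3 * hab (p - e) + 3 * hab (p - e - e) - hab (p - e - e - e))
    - a p * a (p - e - e - e) * h

/-- Exponent count: 2 + (-1) + 2 = 3. In the later orders every Leibniz term has the same total, so
each difference gains exactly one order. -/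
theorem hasDecay_backDiff_of_mul_eq_one (hab : ∀ p, b p * a p = 1) (ha : HasDecay a 2)
    (hb1 : HasDecay (backDiff e b) (-1)) : HasDecay (backDiff e a) 3 := by
  have := ha.mul (hb1.neg.mul (ha.shift e))
  norm_num at this
  rw [funext (backDiff_of_mul_eq_one (e := e) hab)]
  simpa using this

theorem hasDecay_backDiff_two_of_mul_eq_one (hab : ∀ p, b p * a p = 1) (ha : HasDecay a 2)
    (hb1 : HasDecay (backDiff e b) (-1))
    (hb2 : HasDecay (backDiff e (backDiff e b)) 0) :
    HasDecay (backDiff e (backDiff e a)) 4 := by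
  have h1 := hasDecay_backDiff_of_mul_eq_one hab ha hb1
  have h2 := hb1.mul (h1.shift e)
  have h3 := hb2.mul ((ha.shift e).shift e)
  norm_num at h2 h3
  have := ha.mul ((h2.const_mul (-2)).sub h3)
  norm_num at this
  rw [funext (backDiff_two_of_mul_eq_one (e := e) hab)]
  simpa using this

theorem hasDecay_backDiff_three_of_mul_eq_one (hab : ∀ p, b p * a p = 1) (ha : HasDecay a 2)
    (hb1 : HasDecay (backDiff e b) (-1))
    (hb2 : HasDecay (backDiff e (backDiff e b)) 0)
    (hb3 : ∀ p, backDiff e (backDiff e (backDiff e b)) p = 0) :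
    HasDecay (backDiff e (backDiff e (backDiff e a))) 5 := by
  have h1 := hasDecay_backDiff_of_mul_eq_one hab ha hb1
  have h4 := hasDecay_backDiff_two_of_mul_eq_one hab ha hb1 hb2
  have h2 := hb1.mul (h4.shift e)
  have h3 := hb2.mul ((h1.shift e).shift e)
  norm_num at h2 h3
  have := ha.mul ((h2.const_mul (-3)).sub (h3.const_mul 3))
  norm_num at this
  rw [funext (backDiff_three_of_mul_eq_one (e := e) hab hb3)]
  simpa using this

/-- The coefficient identity behind the quadratic extrapolation of
`n ↦ E ^ (-n) * Δ (E ^ n * H)` from `n = 3, 4, 5` to `n = 0`. -/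
theorem backDiff_extrapolation (hab : ∀ p, b p * a p = 1)
    (hb : ∀ p, backDiff e (backDiff e (backDiff e b)) p = 0) (p : ℤ × ℤ) :
    10 * backDiff e (backDiff e fun q => b q * backDiff e (backDiff e (backDiff e a)) q) p
      - 15 * backDiff e
          (fun q => b q * backDiff e (backDiff e (backDiff e (backDiff e a))) q) p
      + 6 * (b p *
          backDiff e (backDiff e (backDiff e (backDiff e (backDiff e a)))) p) = 0 := by
  have h0 := hb p
  have h1 := hb (p - e)
  have h2 := hb (p - e - e)
  simp only [backDiff] at h0 h1 h2 ⊢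
  generalize p - e = p1 at *
  generalize p1 - e = p2 at *
  generalize p2 - e = p3 at *
  generalize p3 - e = p4 at *
  generalize p4 - e = p5 at *
  -- A vanishing third difference is a recurrence, so all six values of b reduce to those at p, p1,
  -- p2, the only ones in the goal.
  have e3 : b p3 = b p - 3 * b p1 + 3 * b p2 := by linear_combination -h0
  have e4 : b p4 = b p1 - 3 * b p2 + 3 * b p3 := by linear_combination -h1
  have e5 : b p5 = b p2 - 3 * b p3 + 3 * b p4 := by linear_combination -h2
  have k0 := hab p
  have k1 := hab p1
  have k2 := hab p2
  have k3 := hab p3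
  have k4 := hab p4
  have k5 := hab p5
  rw [e5, e4, e3] at k5
  rw [e4, e3] at k4
  rw [e3] at k3
  -- The left side is the fifth difference of b·a = 1; the weights are its binomial coefficients.
  linear_combination k0 - 5 * k1 + 10 * k2 - 10 * k3 + 5 * k4 - k5

end Reciprocal

/-! ### Square partial sums and summation by parts -/

/-- The lattice points `(m, n)` with `|m|, |n| ≤ M`. -/
def latticeBox (M : ℕ) : Finset (ℤ × ℤ) :=
  Finset.Icc (-(M : ℤ)) M ×ˢ Finset.Icc (-(M : ℤ)) M

theorem tendsto_latticeBox : Tendsto latticeBox atTop atTop := by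
  refine tendsto_atTop_finset_of_monotone ?_ ?_
  · intro M N h
    have : (M : ℤ) ≤ N := by exact_mod_cast h
    exact Finset.product_subset_product (Finset.Icc_subset_Icc (by omega) this)
      (Finset.Icc_subset_Icc (by omega) this)
  · rintro ⟨m, n⟩
    refine ⟨max m.natAbs n.natAbs, ?_⟩
    simp only [latticeBox, Finset.mem_product, Finset.mem_Icc]
    omega

theorem sum_Icc_sub_pred (g : ℤ → ℂ) (M : ℕ) :
    ∑ m ∈ Finset.Icc (-(M : ℤ)) M, (g m - g (m - 1)) = g M - g (-(M : ℤ) - 1) := by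
  have h : ∀ M : ℕ, ∑ m ∈ Finset.Icc (-(M : ℤ)) M, (g m - g (m - 1))
      = ∑ i ∈ Finset.range (2 * M + 1), (g (-(M : ℤ) - 1 + (i + 1 : ℕ)) - g (-(M : ℤ) - 1 + i)) := by
    intro M
    symm
    refine Finset.sum_bij (fun i _ => -(M : ℤ) + i) ?_ ?_ ?_ ?_
    · intro i hi
      simp only [Finset.mem_range, Finset.mem_Icc] at *
      omega
    · intro i _ j _ h
      omega
    · intro m hm
      simp only [Finset.mem_range, Finset.mem_Icc] at *
      exact ⟨(m + M).toNat, by omega, by omega⟩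
    · intro i _
      congr 2 <;> push_cast <;> ring
  rw [h, Finset.sum_range_sub fun i : ℕ => g (-(M : ℤ) - 1 + i)]
  congr 2
  · push_cast
    ring
  · simp

/-- A row at distance at least M has 2M + 1 entries of size O(M⁻ʳ), for a total of O(M¹⁻ʳ). Such
rows are the boundary terms of summation by parts; x covers both the edge M and the edge -M - 1. -/
theorem tendsto_sum_row {g : ℤ × ℤ → ℂ} {r : ℝ} (hr : 1 < r) (hg : HasDecay g r)
    (x : ℕ → ℤ) (hx : ∀ M : ℕ, (M : ℤ) ≤ |x M|) :
    Tendsto (fun M : ℕ => ∑ n ∈ Finset.Icc (-(M : ℤ)) M, g (x M, n)) atTop (𝓝 0) := by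
  obtain ⟨C, hC0, hC⟩ := hg.exists_pos
  have key : ∀ M : ℕ, ‖∑ n ∈ Finset.Icc (-(M : ℤ)) M, g (x M, n)‖
      ≤ 2 * C * ((M : ℝ) + 1) ^ (-(r - 1)) := by
    intro M
    have hM : (0 : ℝ) < (M : ℝ) + 1 := by positivity
    calc ‖∑ n ∈ Finset.Icc (-(M : ℤ)) M, g (x M, n)‖
        ≤ ∑ n ∈ Finset.Icc (-(M : ℤ)) M, C * ((M : ℝ) + 1) ^ (-r) := by
          refine norm_sum_le_of_le _ fun n _ => (hC _).trans ?_
          refine mul_le_mul_of_nonneg_left (Real.rpow_le_rpow_of_nonpos hM ?_ (by linarith)) hC0.le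
          have h1 : (M : ℝ) ≤ ‖x M‖ := by
            rw [Int.norm_eq_abs]
            exact_mod_cast hx M
          have h2 : ‖x M‖ ≤ ‖((x M, n) : ℤ × ℤ)‖ := norm_fst_le ((x M, n) : ℤ × ℤ)
          unfold latticeWeight
          linarith
      _ = (2 * M + 1) * (C * ((M : ℝ) + 1) ^ (-r)) := by
          rw [Finset.sum_const, Int.card_Icc, nsmul_eq_mul]
          congr 1
          have : ((M : ℤ) + 1 - -(M : ℤ)).toNat = 2 * M + 1 := by omega
          rw [this]
          push_cast
          ring
      _ ≤ (2 * (M + 1)) * (C * ((M : ℝ) + 1) ^ (-r)) := by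
          gcongr
          linarith
      _ = 2 * C * ((M : ℝ) + 1) ^ (-(r - 1)) := by
          rw [show -(r - 1) = 1 + -r by ring, Real.rpow_add hM, Real.rpow_one]
          ring
  refine squeeze_zero_norm key ?_
  have h1 : Tendsto (fun M : ℕ => (M : ℝ) + 1) atTop atTop :=
    tendsto_atTop_add_const_right _ _ tendsto_natCast_atTop_atTop
  have := ((tendsto_rpow_neg_atTop (sub_pos.2 hr)).comp h1).const_mul (2 * C)
  simpa using this

/-- The two coordinate directions of the index lattice. -/
def latticeDir (i : Fin 2) : ℤ × ℤ := if i = 0 then (1, 0) else (0, 1)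

theorem tendsto_sum_backDiff_fst {g : ℤ × ℤ → ℂ} {r : ℝ} (hr : 1 < r) (hg : HasDecay g r) :
    Tendsto (fun M : ℕ => ∑ p ∈ latticeBox M, backDiff (1, 0) g p) atTop (𝓝 0) := by
  have h : ∀ M : ℕ, ∑ p ∈ latticeBox M, backDiff (1, 0) g p
      = (∑ n ∈ Finset.Icc (-(M : ℤ)) M, g (M, n))
        - ∑ n ∈ Finset.Icc (-(M : ℤ)) M, g (-(M : ℤ) - 1, n) := by
    intro M
    rw [latticeBox, Finset.sum_product_right, ← Finset.sum_sub_distrib]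
    refine Finset.sum_congr rfl fun n _ => ?_
    rw [← sum_Icc_sub_pred (fun m => g (m, n))]
    simp [backDiff]
  simp_rw [h]
  have h1 := tendsto_sum_row hr hg (fun M => M) (fun M => le_abs_self _)
  have h2 := tendsto_sum_row hr hg (fun M => -(M : ℤ) - 1) (fun M => by
    rw [abs_of_nonpos] <;> omega)
  simpa using h1.sub h2

theorem tendsto_sum_backDiff {g : ℤ × ℤ → ℂ} {r : ℝ} (hr : 1 < r) (hg : HasDecay g r)
    (i : Fin 2) :
    Tendsto (fun M : ℕ => ∑ p ∈ latticeBox M, backDiff (latticeDir i) g p) atTop (𝓝 0) := by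
  by_cases hi : i = 0
  · simpa [latticeDir, hi] using tendsto_sum_backDiff_fst hr hg
  · have hg' : HasDecay (fun p => g p.swap) r := by
      obtain ⟨C, hC⟩ := hg
      refine ⟨C, fun p => (hC _).trans_eq ?_⟩
      simp [latticeWeight, Prod.norm_def, max_comm]
    refine (tendsto_sum_backDiff_fst hr hg').congr fun M => ?_
    rw [latticeBox, Finset.sum_product, Finset.sum_product_right]
    simp [latticeDir, hi, backDiff]

/-- Summation by parts for the square partial sums of a Fourier series. -/
theorem tendsto_mul_sum_latticeBox {a f : ℤ × ℤ → ℂ} {z : ℂ} {i : Fin 2}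
    (ha : HasDecay a 2) (ha' : HasDecay (backDiff (latticeDir i) a) 3)
    (hf : ∀ p, ‖f p‖ ≤ 1) (hfz : ∀ p, f (p + latticeDir i) = z * f p) :
    Tendsto (fun M : ℕ => (1 - z) * ∑ p ∈ latticeBox M, a p * f p) atTop
      (𝓝 (∑' p, backDiff (latticeDir i) a p * f p)) := by
  have h1 : Tendsto (fun M : ℕ => ∑ p ∈ latticeBox M, backDiff (latticeDir i) a p * f p) atTop
      (𝓝 (∑' p, backDiff (latticeDir i) a p * f p)) :=
    ((ha'.mul_bounded hf).summable (by norm_num)).hasSum.comp tendsto_latticeBox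
  -- With e the direction, (1 - z) a f = (∇a) f - ∇(a f(· + e)); box sums of the last term are pure
  -- boundary terms and decay 2 > 1 makes them vanish.
  have h2 := tendsto_sum_backDiff (by norm_num : (1 : ℝ) < 2)
    (ha.mul_bounded (f := fun p => f (p + latticeDir i)) fun p => hf _) i
  refine (by simpa using h1.sub h2 : Tendsto _ atTop _).congr fun M => ?_
  rw [← Finset.sum_sub_distrib, Finset.mul_sum]
  refine Finset.sum_congr rfl fun p _ => ?_
  have h3 := hfz p
  have h4 := hfz (p - latticeDir i)
  simp only [backDiff, sub_add_cancel] at h4 ⊢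
  rw [h3]
  ring

theorem mul_tsum_eq_tsum_backDiff {c f : ℤ × ℤ → ℂ} {z : ℂ} {e : ℤ × ℤ}
    (hc : Summable fun p => c p * f p) (hfz : ∀ p, f (p + e) = z * f p) :
    (1 - z) * ∑' p, c p * f p = ∑' p, backDiff e c p * f p := by
  have h1 : ∀ p, backDiff e c p * f p = c p * f p - z * (c (p - e) * f (p - e)) := by
    intro p
    have := hfz (p - e)
    rw [sub_add_cancel] at this
    rw [backDiff, this]
    ring
  have h2 : Summable fun p => c (p - e) * f (p - e) :=
    (Equiv.subRight e).summable_iff (f := fun p => c p * f p) |>.2 hc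
  have h3 : ∑' p, c (p - e) * f (p - e) = ∑' p, c p * f p :=
    (Equiv.subRight e).tsum_eq fun p => c p * f p
  simp_rw [h1]
  rw [hc.tsum_sub (h2.mul_left z), tsum_mul_left, h3]
  ring

/-! ### The symbol on the shifted reciprocal lattice -/

/-- The shifted reciprocal lattice point `α + m b₀ + n b₁`. -/
def latticeFreq (l : Module.Basis (Fin 2) ℝ Plane) (α : Plane) (p : ℤ × ℤ) : Plane :=
  α + reciprocalPoint l p.1 p.2

section Symbol

variable (l : Module.Basis (Fin 2) ℝ Plane) (α β : Plane) (k : ℝ)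

theorem latticeFreq_sub (p e : ℤ × ℤ) :
    latticeFreq l α (p - e) = latticeFreq l α p - reciprocalPoint l e.1 e.2 := by
  simp only [latticeFreq, reciprocalPoint, Prod.fst_sub, Prod.snd_sub, Int.cast_sub, sub_smul]
  abel

theorem latticeFreq_add (p e : ℤ × ℤ) :
    latticeFreq l α (p + e) = latticeFreq l α p + reciprocalPoint l e.1 e.2 := by
  simp only [latticeFreq, reciprocalPoint, Prod.fst_add, Prod.snd_add, Int.cast_add, add_smul]
  abel

theorem exists_norm_latticeFreq_le :
    ∃ C : ℝ, 0 < C ∧ ∀ p, ‖latticeFreq l α p‖ ≤ C * latticeWeight p := by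
  refine ⟨‖α‖ + ‖reciprocalVector l 0‖ + ‖reciprocalVector l 1‖ + 1, by positivity, fun p => ?_⟩
  have h0 : ‖(p.1 : ℝ)‖ ≤ ‖p‖ := by simpa [Int.norm_eq_abs] using norm_fst_le p
  have h1 : ‖(p.2 : ℝ)‖ ≤ ‖p‖ := by simpa [Int.norm_eq_abs] using norm_snd_le p
  calc ‖latticeFreq l α p‖
      ≤ ‖α‖ + (‖(p.1 : ℝ) • reciprocalVector l 0‖ + ‖(p.2 : ℝ) • reciprocalVector l 1‖) :=
        (norm_add_le _ _).trans (by gcongr; exact norm_add_le _ _)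
    _ ≤ ‖α‖ + (‖p‖ * ‖reciprocalVector l 0‖ + ‖p‖ * ‖reciprocalVector l 1‖) := by
        rw [norm_smul, norm_smul]
        gcongr
    _ ≤ _ := by
        unfold latticeWeight
        nlinarith [norm_nonneg p, norm_nonneg α, norm_nonneg (reciprocalVector l 0),
          norm_nonneg (reciprocalVector l 1), mul_nonneg (norm_nonneg p) (norm_nonneg α)]

/-- Pairing a reciprocal point with `l i` returns 2π times its i-th index, so the indices are
bounded by the length of the point. -/
theorem exists_latticeWeight_le :
    ∃ C : ℝ, 0 < C ∧ ∀ p, latticeWeight p ≤ C * (1 + ‖latticeFreq l α p‖) := by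
  set K := ‖l 0‖ + ‖l 1‖ with hK
  have hp : ∀ p : ℤ × ℤ, ‖p‖ ≤ K * ‖reciprocalPoint l p.1 p.2‖ := by
    intro p
    have h : ∀ (i : Fin 2) (n : ℤ), ⟪reciprocalPoint l p.1 p.2, l i⟫_ℝ = 2 * Real.pi * n →
        ‖n‖ ≤ ‖l i‖ * ‖reciprocalPoint l p.1 p.2‖ := by
      intro i n h
      have h1 := abs_real_inner_le_norm (reciprocalPoint l p.1 p.2) (l i)
      rw [h, abs_mul, abs_of_pos Real.two_pi_pos, ← Int.norm_eq_abs] at h1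
      nlinarith [Real.pi_gt_three, norm_nonneg n]
    have h0 := h 0 p.1 (by simp [inner_reciprocalPoint])
    have h1 := h 1 p.2 (by simp [inner_reciprocalPoint])
    rw [Prod.norm_def]
    refine max_le (h0.trans ?_) (h1.trans ?_)
    · gcongr
      simp [hK]
    · gcongr
      simp [hK]
  refine ⟨1 + K * (1 + ‖α‖), by positivity, fun p => ?_⟩
  have h1 : ‖reciprocalPoint l p.1 p.2‖ ≤ ‖latticeFreq l α p‖ + ‖α‖ := by
    have := norm_sub_le (latticeFreq l α p) α
    simpa [latticeFreq] using this
  have h2 : K * ‖reciprocalPoint l p.1 p.2‖ ≤ K * (‖latticeFreq l α p‖ + ‖α‖) := by gcongr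
  have hK0 : 0 ≤ K := by positivity
  unfold latticeWeight
  nlinarith [hp p, norm_nonneg α, norm_nonneg (latticeFreq l α p),
    mul_nonneg hK0 (mul_nonneg (norm_nonneg α) (norm_nonneg (latticeFreq l α p)))]

/-- The drift term 2iβ·ξ is purely imaginary, so the real part alone controls |ξ|². -/
theorem norm_sq_le_norm_bandGapSymbol (ξ : Plane) :
    ‖ξ‖ ^ 2 ≤ ‖bandGapSymbol β k ξ‖ + (k ^ 2 + ‖β‖ ^ 2) := by
  have h : (bandGapSymbol β k ξ).re = k ^ 2 + ‖β‖ ^ 2 - ‖ξ‖ ^ 2 := by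
    simp [bandGapSymbol, pow_two]
  have := neg_le_of_abs_le (Complex.abs_re_le_norm (bandGapSymbol β k ξ))
  linarith

/-- The reciprocal of the symbol on the shifted reciprocal lattice. -/
def bandGapCoeff (p : ℤ × ℤ) : ℂ := (bandGapSymbol β k (latticeFreq l α p))⁻¹

variable {l α β k}

/-- Where the symbol has modulus at least B it dominates the squared weight. The remaining indices
form a finite set, on which the coefficient is bounded by its maximum. -/
theorem hasDecay_bandGapCoeff (h : ∀ p, bandGapSymbol β k (latticeFreq l α p) ≠ 0) :
    HasDecay (bandGapCoeff l α β k) 2 := by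
  obtain ⟨A, hA0, hA⟩ := exists_latticeWeight_le l α
  set B := 1 + (k ^ 2 + ‖β‖ ^ 2) with hB
  have hB0 : 0 < B := by positivity
  have key : ∀ p, latticeWeight p ^ 2 ≤
      2 * A ^ 2 * (‖bandGapSymbol β k (latticeFreq l α p)‖ + B) := by
    intro p
    have h1 := norm_sq_le_norm_bandGapSymbol β k (latticeFreq l α p)
    calc latticeWeight p ^ 2 ≤ (A * (1 + ‖latticeFreq l α p‖)) ^ 2 :=
          pow_le_pow_left₀ (latticeWeight_pos p).le (hA p) 2
      _ = A ^ 2 * (1 + ‖latticeFreq l α p‖) ^ 2 := by ring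
      _ ≤ A ^ 2 * (2 * (‖bandGapSymbol β k (latticeFreq l α p)‖ + B)) := by
          gcongr
          nlinarith [sq_nonneg (1 - ‖latticeFreq l α p‖)]
      _ = _ := by ring
  have hfin : {p : ℤ × ℤ | ‖p‖ ≤ 4 * A ^ 2 * B}.Finite := by
    have := (isCompact_closedBall (0 : ℤ × ℤ) (4 * A ^ 2 * B)).finite_of_discrete
    refine this.subset fun p hp => ?_
    simpa using hp
  obtain ⟨m, hm⟩ := (hfin.image fun p => ‖bandGapCoeff l α β k p‖).bddAbove
  refine ⟨max (4 * A ^ 2) (m * (4 * A ^ 2 * B)), fun p => ?_⟩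
  have hw := latticeWeight_pos p
  have h2 : latticeWeight p ^ (-2 : ℝ) = (latticeWeight p ^ 2)⁻¹ := by
    rw [Real.rpow_neg hw.le]
    norm_cast
  rw [h2, ← div_eq_mul_inv, le_div_iff₀ (by positivity)]
  have hs : 0 < ‖bandGapSymbol β k (latticeFreq l α p)‖ := norm_pos_iff.2 (h p)
  rcases le_total B ‖bandGapSymbol β k (latticeFreq l α p)‖ with hle | hle
  · refine le_max_of_le_left ?_
    rw [bandGapCoeff, norm_inv, inv_mul_le_iff₀ hs]
    refine (key p).trans ?_
    nlinarith [sq_nonneg A]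
  · refine le_max_of_le_right ?_
    have h3 : latticeWeight p ^ 2 ≤ 4 * A ^ 2 * B := by
      refine (key p).trans ?_
      nlinarith [sq_nonneg A]
    have h4 : ‖p‖ ≤ 4 * A ^ 2 * B := by
      refine le_trans ?_ h3
      unfold latticeWeight
      nlinarith [norm_nonneg p]
    have h5 : ‖bandGapCoeff l α β k p‖ ≤ m := hm ⟨p, h4, rfl⟩
    exact mul_le_mul h5 h3 (by positivity) ((norm_nonneg _).trans h5)

/-- The symbol is a quadratic polynomial in the index: first differences are affine, second ones
constant, third ones zero. This is what the quotient rules need. -/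
theorem backDiff_bandGapSymbol (e p : ℤ × ℤ) :
    backDiff e (fun p => bandGapSymbol β k (latticeFreq l α p)) p =
      -2 * Complex.I * (⟪β, reciprocalPoint l e.1 e.2⟫_ℝ : ℂ)
        - 2 * (⟪latticeFreq l α p, reciprocalPoint l e.1 e.2⟫_ℝ : ℂ)
        + (‖reciprocalPoint l e.1 e.2‖ : ℂ) ^ 2 := by
  have h := norm_sub_sq_real (latticeFreq l α p) (reciprocalPoint l e.1 e.2)
  have h' : (‖latticeFreq l α p - reciprocalPoint l e.1 e.2‖ : ℂ) ^ 2
      = (‖latticeFreq l α p‖ : ℂ) ^ 2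
        - 2 * (⟪latticeFreq l α p, reciprocalPoint l e.1 e.2⟫_ℝ : ℂ)
        + (‖reciprocalPoint l e.1 e.2‖ : ℂ) ^ 2 := by exact_mod_cast h
  simp only [backDiff, bandGapSymbol, latticeFreq_sub, h', inner_sub_right]
  push_cast
  ring

theorem backDiff_backDiff_bandGapSymbol (e p : ℤ × ℤ) :
    backDiff e (backDiff e fun p => bandGapSymbol β k (latticeFreq l α p)) p =
      -2 * (‖reciprocalPoint l e.1 e.2‖ : ℂ) ^ 2 := by
  rw [backDiff, backDiff_bandGapSymbol, backDiff_bandGapSymbol, latticeFreq_sub, inner_sub_left,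
    real_inner_self_eq_norm_sq]
  push_cast
  ring

theorem backDiff_three_bandGapSymbol (e p : ℤ × ℤ) :
    backDiff e (backDiff e (backDiff e fun p => bandGapSymbol β k (latticeFreq l α p))) p = 0 := by
  rw [backDiff, backDiff_backDiff_bandGapSymbol, backDiff_backDiff_bandGapSymbol, sub_self]

theorem hasDecay_const (z : ℂ) : HasDecay (fun _ => z) 0 := ⟨‖z‖, by simp⟩

theorem hasDecay_inner_latticeFreq (v : Plane) :
    HasDecay (fun p => (⟪latticeFreq l α p, v⟫_ℝ : ℂ)) (-1) := by
  obtain ⟨C, hC0, hC⟩ := exists_norm_latticeFreq_le l α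
  refine ⟨C * ‖v‖, fun p => ?_⟩
  have h1 : ‖(⟪latticeFreq l α p, v⟫_ℝ : ℂ)‖ ≤ ‖latticeFreq l α p‖ * ‖v‖ := by
    rw [Complex.norm_real]
    exact norm_inner_le_norm _ _
  refine h1.trans ?_
  rw [neg_neg, Real.rpow_one, mul_right_comm]
  gcongr
  exact hC p

theorem hasDecay_backDiff_bandGapSymbol (e : ℤ × ℤ) :
    HasDecay (backDiff e fun p => bandGapSymbol β k (latticeFreq l α p)) (-1) := by
  rw [funext (backDiff_bandGapSymbol e)]
  refine (HasDecay.sub ?_ ((hasDecay_inner_latticeFreq _).const_mul 2)).add ?_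
  · exact (hasDecay_const _).mono (by norm_num)
  · exact (hasDecay_const _).mono (by norm_num)

theorem hasDecay_bandGapSymbol :
    HasDecay (fun p => bandGapSymbol β k (latticeFreq l α p)) (-2) := by
  have h : ∀ ξ : Plane, (‖ξ‖ : ℂ) ^ 2 = (⟪ξ, EuclideanSpace.basisFun (Fin 2) ℝ 0⟫_ℝ : ℂ) *
      (⟪ξ, EuclideanSpace.basisFun (Fin 2) ℝ 0⟫_ℝ : ℂ) +
      (⟪ξ, EuclideanSpace.basisFun (Fin 2) ℝ 1⟫_ℝ : ℂ) *
      (⟪ξ, EuclideanSpace.basisFun (Fin 2) ℝ 1⟫_ℝ : ℂ) := by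
    intro ξ
    have := OrthonormalBasis.sum_sq_norm_inner_left (EuclideanSpace.basisFun (Fin 2) ℝ) ξ
    rw [Fin.sum_univ_two] at this
    norm_cast
    rw [← this]
    simp [pow_two]
  have h1 : ∀ i, HasDecay (fun p =>
      (⟪latticeFreq l α p, EuclideanSpace.basisFun (Fin 2) ℝ i⟫_ℝ : ℂ) *
      (⟪latticeFreq l α p, EuclideanSpace.basisFun (Fin 2) ℝ i⟫_ℝ : ℂ)) (-2) := by
    intro i
    have := (hasDecay_inner_latticeFreq (l := l) (α := α)
      (EuclideanSpace.basisFun (Fin 2) ℝ i)).mul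
      (hasDecay_inner_latticeFreq (l := l) (α := α) (EuclideanSpace.basisFun (Fin 2) ℝ i))
    norm_num at this ⊢
    exact this
  simp only [bandGapSymbol, h (latticeFreq l α _)]
  refine (((hasDecay_const _).mono (by norm_num)).sub ?_).sub ((h1 0).add (h1 1))
  have := ((hasDecay_inner_latticeFreq (l := l) (α := α) β).const_mul (2 * Complex.I)).mono
    (by norm_num : (-2 : ℝ) ≤ -1)
  simpa [real_inner_comm] using this

theorem bandGapSymbol_mul_bandGapCoeff (h : ∀ p, bandGapSymbol β k (latticeFreq l α p) ≠ 0)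
    (p : ℤ × ℤ) : bandGapSymbol β k (latticeFreq l α p) * bandGapCoeff l α β k p = 1 :=
  mul_inv_cancel₀ (h p)

theorem hasDecay_backDiff_bandGapCoeff (h : ∀ p, bandGapSymbol β k (latticeFreq l α p) ≠ 0)
    (e : ℤ × ℤ) : HasDecay (backDiff e (bandGapCoeff l α β k)) 3 :=
  hasDecay_backDiff_of_mul_eq_one (bandGapSymbol_mul_bandGapCoeff h) (hasDecay_bandGapCoeff h)
    (hasDecay_backDiff_bandGapSymbol e)

theorem hasDecay_backDiff_two_bandGapCoeff (h : ∀ p, bandGapSymbol β k (latticeFreq l α p) ≠ 0)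
    (e : ℤ × ℤ) : HasDecay (backDiff e (backDiff e (bandGapCoeff l α β k))) 4 := by
  refine hasDecay_backDiff_two_of_mul_eq_one (bandGapSymbol_mul_bandGapCoeff h)
    (hasDecay_bandGapCoeff h) (hasDecay_backDiff_bandGapSymbol e) ?_
  rw [funext (backDiff_backDiff_bandGapSymbol e)]
  exact hasDecay_const _

theorem hasDecay_backDiff_three_bandGapCoeff
    (h : ∀ p, bandGapSymbol β k (latticeFreq l α p) ≠ 0) (e : ℤ × ℤ) :
    HasDecay (backDiff e (backDiff e (backDiff e (bandGapCoeff l α β k)))) 5 := by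
  refine hasDecay_backDiff_three_of_mul_eq_one (bandGapSymbol_mul_bandGapCoeff h)
    (hasDecay_bandGapCoeff h) (hasDecay_backDiff_bandGapSymbol e) ?_
    (backDiff_three_bandGapSymbol e)
  rw [funext (backDiff_backDiff_bandGapSymbol e)]
  exact hasDecay_const _

end Symbol

/-! ### Plane waves and their absolutely convergent series -/

/-- The plane wave `exp (i ξ · x)`. -/
def planeWave (ξ x : Plane) : ℂ := Complex.exp (Complex.I * (⟪ξ, x⟫_ℝ : ℂ))

theorem norm_planeWave (ξ x : Plane) : ‖planeWave ξ x‖ = 1 := by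
  rw [planeWave, mul_comm, Complex.norm_exp_ofReal_mul_I]

theorem planeWave_add (ξ η x : Plane) :
    planeWave (ξ + η) x = planeWave η x * planeWave ξ x := by
  rw [planeWave, planeWave, planeWave, ← Complex.exp_add, inner_add_left]
  push_cast
  ring_nf

theorem planeWave_add_right (ξ x y : Plane) :
    planeWave ξ (x + y) = planeWave ξ x * planeWave ξ y := by
  rw [planeWave, planeWave, planeWave, ← Complex.exp_add, inner_add_right]
  push_cast
  ring_nf

theorem planeWave_zero_right (ξ : Plane) : planeWave ξ 0 = 1 := by simp [planeWave]

theorem norm_planeWave_sub_one_le (ξ x : Plane) : ‖planeWave ξ x - 1‖ ≤ ‖ξ‖ * ‖x‖ := by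
  rw [planeWave, mul_comm]
  refine (Real.norm_exp_I_mul_ofReal_sub_one_le (x := ⟪ξ, x⟫_ℝ)).trans' ?_ |>.trans
    (norm_inner_le_norm ξ x)
  rw [mul_comm]

theorem contDiff_planeWave (ξ : Plane) {n : WithTop ℕ∞} : ContDiff ℝ n (planeWave ξ) := by
  unfold planeWave
  have h : ContDiff ℝ n fun x : Plane => (⟪ξ, x⟫_ℝ : ℂ) :=
    Complex.ofRealCLM.contDiff.comp (contDiff_const.inner ℝ contDiff_id)
  exact (contDiff_const.mul h).cexp

theorem hasDerivAt_exp_I_mul (t : ℝ) :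
    HasDerivAt (fun t : ℝ => Complex.exp (Complex.I * t))
      (Complex.I * Complex.exp (Complex.I * t)) t := by
  have h : HasDerivAt (fun t : ℝ => Complex.I * (t : ℂ)) Complex.I t := by
    simpa using (Complex.ofRealCLM.hasDerivAt (x := t)).const_mul Complex.I
  simpa [mul_comm] using h.cexp

theorem iteratedDeriv_exp_I_mul (n : ℕ) :
    iteratedDeriv n (fun t : ℝ => Complex.exp (Complex.I * t)) =
      fun t : ℝ => Complex.I ^ n * Complex.exp (Complex.I * t) := by
  induction n with
  | zero => simp
  | succ n ih =>
    rw [iteratedDeriv_succ, ih]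
    funext t
    rw [((hasDerivAt_exp_I_mul t).const_mul _).deriv]
    ring

/-- A plane wave is exp(it) composed with the functional ξ·x, so each derivative costs one factor
‖ξ‖. -/
theorem norm_iteratedFDeriv_planeWave_le (ξ x : Plane) (n : ℕ) :
    ‖iteratedFDeriv ℝ n (planeWave ξ) x‖ ≤ ‖ξ‖ ^ n := by
  have h : planeWave ξ = (fun t : ℝ => Complex.exp (Complex.I * t)) ∘ (innerSL ℝ ξ) := rfl
  have hc : ContDiff ℝ n fun t : ℝ => Complex.exp (Complex.I * t) :=
    (contDiff_const.mul Complex.ofRealCLM.contDiff).cexp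
  rw [h, ContinuousLinearMap.iteratedFDeriv_comp_right _ hc _ le_rfl]
  refine (ContinuousMultilinearMap.norm_compContinuousLinearMap_le _ _).trans ?_
  rw [norm_iteratedFDeriv_eq_norm_iteratedDeriv, iteratedDeriv_exp_I_mul, norm_mul, norm_pow,
    Complex.norm_I, mul_comm Complex.I, Complex.norm_exp_ofReal_mul_I]
  simp

/-- The series `∑ c(p) exp (i (α + q_p) · x)` over the reciprocal lattice. -/
def waveSeries (l : Module.Basis (Fin 2) ℝ Plane) (α : Plane) (c : ℤ × ℤ → ℂ) (x : Plane) : ℂ :=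
  ∑' p, c p * planeWave (latticeFreq l α p) x

section WaveSeries

variable {l : Module.Basis (Fin 2) ℝ Plane} {α : Plane} {c : ℤ × ℤ → ℂ} {r : ℝ}

theorem HasDecay.summable_norm_mul_norm_pow (hc : HasDecay c r) (n : ℕ) (hr : 2 + n < r) :
    Summable fun p => ‖c p‖ * ‖latticeFreq l α p‖ ^ n := by
  obtain ⟨C, hC0, hC⟩ := hc.exists_pos
  obtain ⟨A, hA0, hA⟩ := exists_norm_latticeFreq_le l α
  refine Summable.of_nonneg_of_le (fun p => by positivity) (fun p => ?_)
    ((summable_latticeWeight_rpow (r := r - n) (by linarith)).mul_left (C * A ^ n))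
  have hw := latticeWeight_pos p
  calc ‖c p‖ * ‖latticeFreq l α p‖ ^ n
      ≤ (C * latticeWeight p ^ (-r)) * (A * latticeWeight p) ^ n := by
        gcongr
        exacts [hC p, hA p]
    _ = _ := by
        rw [show -(r - n) = -r + n by ring, Real.rpow_add hw, Real.rpow_natCast]
        ring

theorem HasDecay.summable_mul_planeWave (hc : HasDecay c r) (hr : 2 < r) (x : Plane) :
    Summable fun p => c p * planeWave (latticeFreq l α p) x :=
  (hc.mul_bounded (B := 1) fun _ => (norm_planeWave _ _).le).summable hr

/-- Two derivatives cost two orders and summability over ℤ² needs more than two. Hence three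
differences of the coefficients, with exponent 5, suffice. -/
theorem contDiff_waveSeries (hc : HasDecay c r) (hr : 4 < r) :
    ContDiff ℝ 2 (waveSeries l α c) := by
  refine contDiff_tsum (N := 2) (v := fun n p => ‖c p‖ * ‖latticeFreq l α p‖ ^ n)
    (fun p => contDiff_const.mul (contDiff_planeWave _)) ?_ ?_
  · intro n hn
    have : (n : ℝ) ≤ 2 := by exact_mod_cast hn
    exact hc.summable_norm_mul_norm_pow n (by linarith)
  · intro n p x _
    have h := iteratedFDeriv_const_smul_apply (𝕜 := ℝ) (i := n) (a := c p) (x := x)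
      (contDiff_planeWave (latticeFreq l α p)).contDiffAt
    change ‖iteratedFDeriv ℝ n (c p • planeWave (latticeFreq l α p)) x‖ ≤ _
    rw [h, norm_smul]
    gcongr
    exact norm_iteratedFDeriv_planeWave_le _ _ _

theorem planeWave_latticeFreq_add (e p : ℤ × ℤ) (x : Plane) :
    planeWave (latticeFreq l α (p + e)) x =
      planeWave (reciprocalPoint l e.1 e.2) x * planeWave (latticeFreq l α p) x := by
  rw [latticeFreq_add, planeWave_add]

/-- The dictionary of the whole argument: a factor that vanishes on the lattice becomes a difference
of coefficients. -/
theorem one_sub_mul_waveSeries (hc : HasDecay c r) (hr : 2 < r) (e : ℤ × ℤ) (x : Plane) :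
    (1 - planeWave (reciprocalPoint l e.1 e.2) x) * waveSeries l α c x =
      waveSeries l α (backDiff e c) x :=
  mul_tsum_eq_tsum_backDiff (hc.summable_mul_planeWave hr x)
    fun p => planeWave_latticeFreq_add e p x

theorem hasDerivAt_planeWave_line (ξ x v : Plane) (t : ℝ) :
    HasDerivAt (fun t : ℝ => planeWave ξ (x + t • v))
      (Complex.I * (⟪ξ, v⟫_ℝ : ℂ) * planeWave ξ (x + t • v)) t := by
  have h1 : HasDerivAt (fun t : ℝ => ⟪ξ, x + t • v⟫_ℝ) ⟪ξ, v⟫_ℝ t := by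
    simp only [inner_add_right, inner_smul_right]
    simpa using ((hasDerivAt_id t).mul_const ⟪ξ, v⟫_ℝ).const_add ⟪ξ, x⟫_ℝ
  have h2 := (hasDerivAt_exp_I_mul ⟪ξ, x + t • v⟫_ℝ).scomp t h1
  refine h2.congr_deriv ?_
  rw [Complex.real_smul, planeWave]
  ring

theorem hasDerivAt_waveSeries_line (hc : HasDecay c r) (hr : 3 < r) (x v : Plane) (t : ℝ) :
    HasDerivAt (fun t : ℝ => waveSeries l α c (x + t • v))
      (waveSeries l α (fun p => c p * (Complex.I * (⟪latticeFreq l α p, v⟫_ℝ : ℂ)))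
        (x + t • v)) t := by
  have hu := (hc.summable_norm_mul_norm_pow (l := l) (α := α) 1 (by norm_num; linarith)).mul_right
    ‖v‖
  have := hasDerivAt_tsum (y₀ := (0 : ℝ)) hu
    (fun p t => (hasDerivAt_planeWave_line (latticeFreq l α p) x v t).const_mul (c p)) ?_
    (hc.summable_mul_planeWave (by linarith) _) t
  · simpa only [waveSeries, mul_assoc] using this
  · intro p t
    rw [norm_mul, norm_mul, norm_planeWave, mul_one, norm_mul, Complex.norm_I, one_mul, pow_one,
      mul_assoc, Complex.norm_real]
    gcongr
    exact norm_inner_le_norm _ _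

end WaveSeries

/-! ### Second derivatives along lines -/

/-- Passing to lines lets every Leibniz computation with the Laplacian be done in one variable. -/
theorem iteratedFDeriv_two_eq_deriv_deriv {u : Plane → ℂ} {x : Plane}
    (hu : ContDiffAt ℝ 2 u x) (v : Plane) :
    iteratedFDeriv ℝ 2 u x ![v, v] = deriv (deriv fun t : ℝ => u (x + t • v)) 0 := by
  have hl : ∀ t : ℝ, HasDerivAt (fun t : ℝ => x + t • v) v t := fun t => by
    simpa using ((hasDerivAt_id t).smul_const v).const_add x
  have hx : x + (0 : ℝ) • v = x := by simp
  have h1 : ∀ᶠ t : ℝ in 𝓝 0, deriv (fun t : ℝ => u (x + t • v)) t = fderiv ℝ u (x + t • v) v := by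
    have h2 : ∀ᶠ y in 𝓝 x, ContDiffAt ℝ 2 u y := hu.eventually (by simp)
    have h3 : Tendsto (fun t : ℝ => x + t • v) (𝓝 0) (𝓝 x) := by
      have := (hl 0).continuousAt.tendsto
      rwa [hx] at this
    filter_upwards [h3.eventually h2] with t ht
    exact ((ht.differentiableAt (by norm_num)).hasFDerivAt.comp_hasDerivAt t (hl t)).deriv
  have h4 : HasFDerivAt (fderiv ℝ u) (fderiv ℝ (fderiv ℝ u) x) (x + (0 : ℝ) • v) := by
    rw [hx]
    exact ((hu.fderiv_right (m := 1) (by norm_num)).differentiableAt (by norm_num)).hasFDerivAt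
  have h5 : HasDerivAt (fun t : ℝ => fderiv ℝ u (x + t • v) v)
      (fderiv ℝ (fderiv ℝ u) x v v) 0 :=
    (ContinuousLinearMap.apply ℝ ℂ v).hasFDerivAt.comp_hasDerivAt (0 : ℝ)
      (h4.comp_hasDerivAt (0 : ℝ) (hl 0))
  rw [EventuallyEq.deriv_eq h1, iteratedFDeriv_two_apply, h5.deriv]
  rfl

theorem laplacian_eq_sum_deriv_deriv {u : Plane → ℂ} {x : Plane} (hu : ContDiffAt ℝ 2 u x) :
    Laplacian.laplacian u x =
      ∑ i, deriv (deriv fun t : ℝ => u (x + t • EuclideanSpace.basisFun (Fin 2) ℝ i)) 0 := by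
  rw [InnerProductSpace.laplacian_eq_iteratedFDeriv_orthonormalBasis u
    (EuclideanSpace.basisFun (Fin 2) ℝ)]
  exact Finset.sum_congr rfl fun i _ => iteratedFDeriv_two_eq_deriv_deriv hu _

theorem ContDiffAt.comp_line {u : Plane → ℂ} {x : Plane} (hu : ContDiffAt ℝ 2 u x) (v : Plane) :
    ContDiffAt ℝ 2 (fun t : ℝ => u (x + t • v)) 0 := by
  have hx : x + (0 : ℝ) • v = x := by simp
  refine ContDiffAt.comp (0 : ℝ) (g := u) (by rwa [hx]) ?_
  exact contDiffAt_const.add (contDiffAt_id.smul contDiffAt_const)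

theorem deriv_deriv_mul {f g : ℝ → ℂ} {t : ℝ} (hf : ContDiffAt ℝ 2 f t)
    (hg : ContDiffAt ℝ 2 g t) :
    deriv (deriv fun s => f s * g s) t =
      deriv (deriv f) t * g t + 2 * (deriv f t * deriv g t) + f t * deriv (deriv g) t := by
  have h1 : ∀ᶠ s in 𝓝 t, deriv (fun s => f s * g s) s = deriv f s * g s + f s * deriv g s := by
    filter_upwards [hf.eventually (by simp), hg.eventually (by simp)] with s hs hs'
    exact ((hs.differentiableAt (by norm_num)).hasDerivAt.mul
      (hs'.differentiableAt (by norm_num)).hasDerivAt).deriv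
  have hf1 := (hf.differentiableAt (by norm_num)).hasDerivAt
  have hg1 := (hg.differentiableAt (by norm_num)).hasDerivAt
  have hd : ∀ {f : ℝ → ℂ}, ContDiffAt ℝ 2 f t → HasDerivAt (deriv f) (deriv (deriv f) t) t := by
    intro f hf
    have h := (hf.fderiv_right (m := 1) (by norm_num)).clm_apply
      (contDiffAt_const (c := (1 : ℝ)))
    exact (h.differentiableAt (by norm_num)).hasDerivAt
  refine (EventuallyEq.deriv_eq h1).trans ?_
  refine (((hd hf).mul hg1).add (hf1.mul (hd hg))).deriv.trans ?_
  ring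

/-! ### The band gap Green's function away from the lattice -/

/-- The real exponential `exp (-β · x)`. -/
def expWeight (β x : Plane) : ℂ := Complex.exp (-(⟪β, x⟫_ℝ : ℂ))

theorem contDiff_expWeight (β : Plane) {n : WithTop ℕ∞} : ContDiff ℝ n (expWeight β) := by
  unfold expWeight
  have h : ContDiff ℝ n fun x : Plane => (⟪β, x⟫_ℝ : ℂ) :=
    Complex.ofRealCLM.contDiff.comp (contDiff_const.inner ℝ contDiff_id)
  exact h.neg.cexp

theorem expWeight_ne_zero (β x : Plane) : expWeight β x ≠ 0 := Complex.exp_ne_zero _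

theorem expWeight_add (β x y : Plane) : expWeight β (x + y) = expWeight β x * expWeight β y := by
  rw [expWeight, expWeight, expWeight, ← Complex.exp_add, inner_add_right]
  push_cast
  ring_nf

theorem hasDerivAt_expWeight_line (β x v : Plane) (t : ℝ) :
    HasDerivAt (fun t : ℝ => expWeight β (x + t • v))
      (-(⟪β, v⟫_ℝ : ℂ) * expWeight β (x + t • v)) t := by
  have h1 : HasDerivAt (fun t : ℝ => ⟪β, x + t • v⟫_ℝ) ⟪β, v⟫_ℝ t := by
    simp only [inner_add_right, inner_smul_right]
    simpa using ((hasDerivAt_id t).mul_const ⟪β, v⟫_ℝ).const_add ⟪β, x⟫_ℝ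
  refine h1.ofReal_comp.neg.cexp.congr_deriv ?_
  simp only [expWeight, Pi.neg_apply]
  ring

section Series

variable {l : Module.Basis (Fin 2) ℝ Plane} {α : Plane} {c : ℤ × ℤ → ℂ} {r : ℝ}

/-- On exp(-β·x) exp(iξ·x), a derivative along v is multiplication by i ξ·v - β·v. Termwise
differentiation leaves decay r - 2 > 2. -/
theorem deriv_deriv_expWeight_mul_waveSeries (hc : HasDecay c r) (hr : 4 < r)
    (β x v : Plane) :
    deriv (deriv fun t : ℝ => expWeight β (x + t • v) * waveSeries l α c (x + t • v)) 0 =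
      expWeight β x * waveSeries l α (fun p => c p *
        (Complex.I * (⟪latticeFreq l α p, v⟫_ℝ : ℂ) - (⟪β, v⟫_ℝ : ℂ)) ^ 2) x := by
  have hc1 : HasDecay (fun p => c p * (Complex.I * (⟪latticeFreq l α p, v⟫_ℝ : ℂ))) (r - 1) := by
    simpa [sub_eq_add_neg] using
      hc.mul ((hasDecay_inner_latticeFreq (l := l) (α := α) v).const_mul Complex.I)
  have hc2 : HasDecay (fun p => c p * (Complex.I * (⟪latticeFreq l α p, v⟫_ℝ : ℂ)) *
      (Complex.I * (⟪latticeFreq l α p, v⟫_ℝ : ℂ))) (r - 1 - 1) := by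
    simpa [sub_eq_add_neg] using
      hc1.mul ((hasDecay_inner_latticeFreq (l := l) (α := α) v).const_mul Complex.I)
  have hA := (contDiff_expWeight β (n := 2)).contDiffAt (x := x) |>.comp_line v
  have hW := (contDiff_waveSeries (l := l) (α := α) hc hr).contDiffAt (x := x) |>.comp_line v
  have hA1 : (deriv fun t : ℝ => expWeight β (x + t • v)) =
      fun t => -(⟪β, v⟫_ℝ : ℂ) * expWeight β (x + t • v) :=
    funext fun t => (hasDerivAt_expWeight_line β x v t).deriv
  have hW1 : (deriv fun t : ℝ => waveSeries l α c (x + t • v)) =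
      fun t => waveSeries l α (fun p => c p *
        (Complex.I * (⟪latticeFreq l α p, v⟫_ℝ : ℂ))) (x + t • v) :=
    funext fun t => (hasDerivAt_waveSeries_line hc (by linarith) x v t).deriv
  rw [deriv_deriv_mul hA hW, hA1, hW1,
    ((hasDerivAt_expWeight_line β x v 0).const_mul _).deriv,
    (hasDerivAt_waveSeries_line hc1 (by linarith) x v 0).deriv]
  simp only [zero_smul, add_zero]
  have s0 := (hc.summable_mul_planeWave (l := l) (α := α) (by linarith) x).mul_left
    ((⟪β, v⟫_ℝ : ℂ) ^ 2)
  have s1 := (hc1.summable_mul_planeWave (l := l) (α := α) (by linarith) x).mul_left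
    (-2 * (⟪β, v⟫_ℝ : ℂ))
  have s2 := hc2.summable_mul_planeWave (l := l) (α := α) (by linarith) x
  have key : waveSeries l α (fun p => c p *
        (Complex.I * (⟪latticeFreq l α p, v⟫_ℝ : ℂ) - (⟪β, v⟫_ℝ : ℂ)) ^ 2) x =
      (⟪β, v⟫_ℝ : ℂ) ^ 2 * waveSeries l α c x +
      -2 * (⟪β, v⟫_ℝ : ℂ) * waveSeries l α (fun p => c p *
        (Complex.I * (⟪latticeFreq l α p, v⟫_ℝ : ℂ))) x +
      waveSeries l α (fun p => c p * (Complex.I * (⟪latticeFreq l α p, v⟫_ℝ : ℂ)) *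
      (Complex.I * (⟪latticeFreq l α p, v⟫_ℝ : ℂ))) x := by
    simp only [waveSeries]
    rw [← tsum_mul_left, ← tsum_mul_left, ← s0.tsum_add s1, ← (s0.add s1).tsum_add s2]
    refine tsum_congr fun p => ?_
    ring
  rw [key]
  ring

/-- The reason for the factor exp(-β·x): conjugation turns the operator behind the symbol into Δ +
k². -/
theorem sum_sq_eq_bandGapSymbol (β ξ : Plane) (k : ℝ) :
    ∑ i, (Complex.I * (⟪ξ, EuclideanSpace.basisFun (Fin 2) ℝ i⟫_ℝ : ℂ)
      - (⟪β, EuclideanSpace.basisFun (Fin 2) ℝ i⟫_ℝ : ℂ)) ^ 2 + (k : ℂ) ^ 2 =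
      bandGapSymbol β k ξ := by
  have h1 : ∀ η : Plane, (‖η‖ : ℂ) ^ 2 = (η 0 : ℂ) ^ 2 + (η 1 : ℂ) ^ 2 := by
    intro η
    have := EuclideanSpace.real_norm_sq_eq η
    rw [Fin.sum_univ_two] at this
    exact_mod_cast this
  have h2 : (⟪β, ξ⟫_ℝ : ℂ) = (β 0 : ℂ) * ξ 0 + β 1 * ξ 1 := by
    simp [PiLp.inner_apply, Fin.sum_univ_two, mul_comm]
  rw [bandGapSymbol, h1, h1, h2, Fin.sum_univ_two]
  simp only [EuclideanSpace.basisFun_apply, EuclideanSpace.inner_single_right, one_mul,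
    conj_trivial]
  linear_combination ((ξ 0 : ℂ) ^ 2 + (ξ 1 : ℂ) ^ 2) * Complex.I_sq

theorem laplacian_expWeight_mul_waveSeries (hc : HasDecay c r) (hr : 4 < r) (β x : Plane)
    (k : ℝ) :
    Laplacian.laplacian (fun y => expWeight β y * waveSeries l α c y) x
        + (k : ℂ) ^ 2 * (expWeight β x * waveSeries l α c x) =
      expWeight β x *
        waveSeries l α (fun p => bandGapSymbol β k (latticeFreq l α p) * c p) x := by
  have hd : ContDiffAt ℝ 2 (fun y => expWeight β y * waveSeries l α c y) x :=
    ((contDiff_expWeight β).mul (contDiff_waveSeries hc hr)).contDiffAt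
  rw [laplacian_eq_sum_deriv_deriv hd]
  simp only [deriv_deriv_expWeight_mul_waveSeries hc hr]
  have hs : ∀ i, Summable fun p => c p * (Complex.I *
      (⟪latticeFreq l α p, EuclideanSpace.basisFun (Fin 2) ℝ i⟫_ℝ : ℂ)
      - (⟪β, EuclideanSpace.basisFun (Fin 2) ℝ i⟫_ℝ : ℂ)) ^ 2 *
        planeWave (latticeFreq l α p) x := by
    intro i
    have h1 : HasDecay (fun p => Complex.I *
      (⟪latticeFreq l α p, EuclideanSpace.basisFun (Fin 2) ℝ i⟫_ℝ : ℂ)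
      - (⟪β, EuclideanSpace.basisFun (Fin 2) ℝ i⟫_ℝ : ℂ)) (-1) :=
      ((hasDecay_inner_latticeFreq _).const_mul _).sub ((hasDecay_const _).mono (by norm_num))
    have h2 := hc.mul (h1.mul h1)
    simp only [← pow_two] at h2
    exact h2.summable_mul_planeWave (by linarith) x
  have s0 := (hc.summable_mul_planeWave (l := l) (α := α) (by linarith) x).mul_left ((k : ℂ) ^ 2)
  rw [← Finset.mul_sum, mul_left_comm, ← mul_add]
  congr 1
  simp only [waveSeries]
  rw [← Summable.tsum_finsetSum fun i _ => hs i, ← tsum_mul_left,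
    ← (summable_sum fun i _ => hs i).tsum_add s0]
  refine tsum_congr fun p => ?_
  rw [← sum_sq_eq_bandGapSymbol, ← Finset.sum_mul, ← Finset.mul_sum]
  ring

end Series

/-- Quadratic extrapolation of the second derivative of `E ^ n * h` in `n`. -/
theorem deriv_deriv_extrapolation {E h : ℝ → ℂ} {t : ℝ} (hE : ContDiffAt ℝ 2 E t)
    (hh : ContDiffAt ℝ 2 h t) :
    E t ^ 5 * deriv (deriv h) t =
      10 * E t ^ 2 * deriv (deriv fun s => E s ^ 3 * h s) t
        - 15 * E t * deriv (deriv fun s => E s ^ 4 * h s) t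
        + 6 * deriv (deriv fun s => E s ^ 5 * h s) t := by
  have hC : ∀ n : ℕ, ContDiffAt ℝ 2 (fun s => E s ^ n * h s) t := fun n => (hE.pow n).mul hh
  have h1 : ∀ n : ℕ, deriv (fun s => E s ^ (n + 1) * h s) t =
      deriv E t * (E t ^ n * h t) + E t * deriv (fun s => E s ^ n * h s) t := by
    intro n
    have := (hE.differentiableAt (by norm_num)).hasDerivAt.mul
      ((hC n).differentiableAt (by norm_num)).hasDerivAt
    rw [← this.deriv]
    congr 1
    funext s
    simp only [Pi.mul_apply]
    ring
  have h2 : ∀ n : ℕ, deriv (deriv fun s => E s ^ (n + 1) * h s) t =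
      deriv (deriv E) t * (E t ^ n * h t)
        + 2 * (deriv E t * deriv (fun s => E s ^ n * h s) t)
        + E t * deriv (deriv fun s => E s ^ n * h s) t := by
    intro n
    rw [← deriv_deriv_mul hE (hC n)]
    congr 2
    funext s
    ring
  have h0 : (fun s => E s ^ 0 * h s) = h := by
    funext s
    simp
  -- Unrolled, E⁻ⁿ (Eⁿ h)'' is quadratic in n, and 10, -15, 6 are the Lagrange weights at 0 for the
  -- nodes 3, 4, 5. Multiplication by E⁵ avoids dividing by E.
  rw [h2 4, h2 3, h2 2, h2 1, h2 0, h1 3, h1 2, h1 1, h1 0, h0]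
  ring

theorem laplacian_extrapolation {E h : Plane → ℂ} {x : Plane} (hE : ContDiffAt ℝ 2 E x)
    (hh : ContDiffAt ℝ 2 h x) :
    E x ^ 5 * Laplacian.laplacian h x =
      10 * E x ^ 2 * Laplacian.laplacian (fun y => E y ^ 3 * h y) x
        - 15 * E x * Laplacian.laplacian (fun y => E y ^ 4 * h y) x
        + 6 * Laplacian.laplacian (fun y => E y ^ 5 * h y) x := by
  rw [laplacian_eq_sum_deriv_deriv hh, laplacian_eq_sum_deriv_deriv ((hE.pow 3).mul hh),
    laplacian_eq_sum_deriv_deriv ((hE.pow 4).mul hh),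
    laplacian_eq_sum_deriv_deriv ((hE.pow 5).mul hh)]
  simp only [Finset.mul_sum]
  rw [← Finset.sum_sub_distrib, ← Finset.sum_add_distrib]
  refine Finset.sum_congr rfl fun i _ => ?_
  have := deriv_deriv_extrapolation
    (hE.comp_line (EuclideanSpace.basisFun (Fin 2) ℝ i))
    (hh.comp_line (EuclideanSpace.basisFun (Fin 2) ℝ i))
  simpa using this

/-! ### Regularity, Helmholtz equation and singularity of the Green's function -/

section Green

variable {l : Module.Basis (Fin 2) ℝ Plane} {α β : Plane} {k : ℝ}

theorem reciprocalPoint_latticeDir (i : Fin 2) :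
    reciprocalPoint l (latticeDir i).1 (latticeDir i).2 = reciprocalVector l i := by
  fin_cases i <;> simp [latticeDir, reciprocalPoint]

theorem bandGapGreenPartialSum_eq (M : ℕ) (x : Plane) :
    bandGapGreenPartialSum l α β k M x = ((volume.real (unitCell l) : ℝ) : ℂ)⁻¹ *
      ∑ p ∈ latticeBox M, bandGapCoeff l α β k p * planeWave (latticeFreq l α p) x := by
  rw [bandGapGreenPartialSum, latticeBox, Finset.sum_product]
  simp only [planeWave, bandGapCoeff, latticeFreq, div_eq_inv_mul]

/-- The points where both exponentials `exp (i bⱼ · x)` equal `1`, that is, the lattice. -/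
def latticeSingular (l : Module.Basis (Fin 2) ℝ Plane) : Set Plane :=
  {x | ∀ i, planeWave (reciprocalVector l i) x = 1}

theorem isClosed_latticeSingular : IsClosed (latticeSingular l) := by
  rw [latticeSingular, Set.ofPred_forall]
  exact isClosed_iInter fun i =>
    isClosed_eq (contDiff_planeWave (n := 0) _).continuous continuous_const

theorem notMem_latticeSingular {x : Plane} :
    x ∉ latticeSingular l ↔ ∃ i, planeWave (reciprocalVector l i) x ≠ 1 :=
  not_forall

theorem planeWave_reciprocalVector (i : Fin 2) (x : Plane) :
    planeWave (reciprocalVector l i) x =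
      Complex.exp (Complex.I * ((2 * Real.pi * l.repr x i : ℝ) : ℂ)) := by
  rw [planeWave, inner_reciprocalVector]

theorem planeWave_reciprocalVector_eq_one_iff (i : Fin 2) (x : Plane) :
    planeWave (reciprocalVector l i) x = 1 ↔ ∃ n : ℤ, l.repr x i = n := by
  rw [planeWave_reciprocalVector, Complex.exp_eq_one_iff]
  refine exists_congr fun n => ?_
  have h : (2 * (Real.pi : ℂ) * Complex.I) ≠ 0 := Complex.two_pi_I_ne_zero
  rw [show Complex.I * ((2 * Real.pi * l.repr x i : ℝ) : ℂ)
    = (l.repr x i : ℂ) * (2 * (Real.pi : ℂ) * Complex.I) by push_cast; ring,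
    mul_left_inj' h]
  exact_mod_cast Iff.rfl

theorem countable_latticeSingular : (latticeSingular l).Countable := by
  have h : latticeSingular l ⊆ range fun p : ℤ × ℤ => (p.1 : ℝ) • l 0 + (p.2 : ℝ) • l 1 := by
    intro x hx
    obtain ⟨m, hm⟩ := (planeWave_reciprocalVector_eq_one_iff 0 x).1 (hx 0)
    obtain ⟨n, hn⟩ := (planeWave_reciprocalVector_eq_one_iff 1 x).1 (hx 1)
    refine ⟨(m, n), ?_⟩
    rw [← l.sum_repr x, Fin.sum_univ_two, hm, hn]
  exact (countable_range _).mono h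

/-- After multiplication by the power, the series may be differentiated twice termwise, and the
Helmholtz operator multiplies coefficients by the symbol. The assumption ranges over all y since the
Laplacian at x needs a neighbourhood. -/
theorem laplacian_pow_mul_expWeight_mul_bandGapGreen {i : Fin 2} {x : Plane}
    (hx : planeWave (reciprocalVector l i) x ≠ 1) {c : ℤ × ℤ → ℂ} (hc : HasDecay c 5) {n : ℕ}
    (hn : ∀ y, planeWave (reciprocalVector l i) y ≠ 1 →
      (1 - planeWave (reciprocalVector l i) y) ^ n * bandGapGreen l α β k y =
        ((volume.real (unitCell l) : ℝ) : ℂ)⁻¹ * waveSeries l α c y) :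
    Laplacian.laplacian (fun y => (1 - planeWave (reciprocalVector l i) y) ^ n *
        (expWeight β y * bandGapGreen l α β k y)) x
      + (k : ℂ) ^ 2 * ((1 - planeWave (reciprocalVector l i) x) ^ n *
        (expWeight β x * bandGapGreen l α β k x)) =
      ((volume.real (unitCell l) : ℝ) : ℂ)⁻¹ * (expWeight β x *
        waveSeries l α (fun p => bandGapSymbol β k (latticeFreq l α p) * c p) x) := by
  have hne : ∀ᶠ y in 𝓝 x, planeWave (reciprocalVector l i) y ≠ 1 :=
    (contDiff_planeWave (n := 0) _).continuous.continuousAt.eventually_ne hx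
  have heq : (fun y => (1 - planeWave (reciprocalVector l i) y) ^ n *
        (expWeight β y * bandGapGreen l α β k y)) =ᶠ[𝓝 x]
      (((volume.real (unitCell l) : ℝ) : ℂ)⁻¹ • fun y => expWeight β y * waveSeries l α c y) := by
    filter_upwards [hne] with y hy
    rw [mul_left_comm, hn y hy, Pi.smul_apply, smul_eq_mul]
    ring
  have hd : ContDiffAt ℝ 2 (fun y => expWeight β y * waveSeries l α c y) x :=
    ((contDiff_expWeight β).mul (contDiff_waveSeries hc (by norm_num))).contDiffAt
  have hval := heq.self_of_nhds
  simp only at hval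
  rw [(InnerProductSpace.laplacian_congr_nhds heq).self_of_nhds,
    InnerProductSpace.laplacian_smul _ hd, hval,
    ← laplacian_expWeight_mul_waveSeries hc (by norm_num)]
  simp only [Pi.smul_apply, smul_eq_mul]
  ring

/-- Interpolation between the linear bound and the trivial bound 2. The exponent 3/4 costs a series
of decay 3 only 3/4 of an order, leaving 9/4 > 2. -/
theorem norm_planeWave_sub_one_le_rpow (ξ x : Plane) :
    ‖planeWave ξ x - 1‖ ≤ 2 * (‖ξ‖ * ‖x‖) ^ (3 / 4 : ℝ) := by
  have h1 := norm_planeWave_sub_one_le ξ x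
  have h2 : ‖planeWave ξ x - 1‖ ≤ 2 := by
    refine (norm_sub_le _ _).trans ?_
    rw [norm_planeWave, norm_one]
    norm_num
  have h0 : 0 ≤ ‖ξ‖ * ‖x‖ := by positivity
  rcases le_total (‖ξ‖ * ‖x‖) 1 with h3 | h3
  · have h4 := Real.rpow_le_rpow_of_exponent_ge' h0 h3 (by norm_num : (0 : ℝ) ≤ 3 / 4)
      (by norm_num : (3 / 4 : ℝ) ≤ 1)
    rw [Real.rpow_one] at h4
    linarith
  · have h4 := Real.one_le_rpow h3 (by norm_num : (0 : ℝ) ≤ 3 / 4)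
    linarith

/-- |1 - exp(2πit)| = 2|sin πt|, and Jordan's inequality gives |sin πt| ≥ 2|t| for |t| ≤ 1/2. -/
theorem four_mul_abs_le_norm_one_sub_planeWave {i : Fin 2} {x : Plane}
    (hx : |l.repr x i| ≤ 1 / 2) :
    4 * |l.repr x i| ≤ ‖1 - planeWave (reciprocalVector l i) x‖ := by
  rw [planeWave_reciprocalVector, norm_sub_rev, Complex.norm_exp_I_mul_ofReal_sub_one,
    Real.norm_eq_abs, abs_mul, abs_two,
    show 2 * Real.pi * l.repr x i / 2 = Real.pi * l.repr x i by ring]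
  have hpi := Real.pi_pos
  have h1 : |Real.sin (Real.pi * l.repr x i)| = Real.sin (Real.pi * |l.repr x i|) := by
    rcases le_total 0 (l.repr x i) with h0 | h0
    · rw [abs_of_nonneg h0] at hx ⊢
      exact abs_of_nonneg (Real.sin_nonneg_of_nonneg_of_le_pi (by positivity) (by nlinarith))
    · rw [abs_of_nonpos h0] at hx ⊢
      rw [← abs_neg, ← Real.sin_neg, mul_neg]
      exact abs_of_nonneg (Real.sin_nonneg_of_nonneg_of_le_pi (by nlinarith) (by nlinarith))
  have h2 := Real.mul_le_sin (x := Real.pi * |l.repr x i|) (by positivity) (by nlinarith)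
  rw [h1]
  have h3 : 2 / Real.pi * (Real.pi * |l.repr x i|) = 2 * |l.repr x i| := by
    field_simp
  linarith

theorem planeWave_reciprocalPoint_add_lattice (p : ℤ × ℤ) (m : Fin 2 → ℤ) :
    planeWave (reciprocalPoint l p.1 p.2) (∑ i, (m i : ℝ) • l i) = 1 := by
  rw [planeWave, inner_reciprocalPoint, Complex.exp_eq_one_iff]
  refine ⟨p.1 * m 0 + p.2 * m 1, ?_⟩
  simp [Fin.sum_univ_two]
  ring

/-- No condition on x is imposed: away from the lattice this gives convergence, and at 0 it shows
that the differenced series vanishes. -/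
theorem tendsto_mul_bandGapGreenPartialSum (h : ∀ p, bandGapSymbol β k (latticeFreq l α p) ≠ 0)
    (i : Fin 2) (x : Plane) :
    Tendsto (fun M => (1 - planeWave (reciprocalVector l i) x) *
        bandGapGreenPartialSum l α β k M x) atTop
      (𝓝 (((volume.real (unitCell l) : ℝ) : ℂ)⁻¹ *
        waveSeries l α (backDiff (latticeDir i) (bandGapCoeff l α β k)) x)) := by
  have := (tendsto_mul_sum_latticeBox (hasDecay_bandGapCoeff h)
    (hasDecay_backDiff_bandGapCoeff h (latticeDir i)) (f := fun p => planeWave (latticeFreq l α p) x)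
    (z := planeWave (reciprocalVector l i) x) (fun p => (norm_planeWave _ _).le)
    (fun p => by rw [planeWave_latticeFreq_add, reciprocalPoint_latticeDir])).const_mul
    ((volume.real (unitCell l) : ℝ) : ℂ)⁻¹
  refine this.congr fun M => ?_
  rw [bandGapGreenPartialSum_eq]
  ring

theorem tendsto_bandGapGreenPartialSum (h : ∀ p, bandGapSymbol β k (latticeFreq l α p) ≠ 0)
    {i : Fin 2} {x : Plane}
    (hx : planeWave (reciprocalVector l i) x ≠ 1) :
    Tendsto (fun M => bandGapGreenPartialSum l α β k M x) atTop
      (𝓝 ((1 - planeWave (reciprocalVector l i) x)⁻¹ * (((volume.real (unitCell l) : ℝ) : ℂ)⁻¹ *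
        waveSeries l α (backDiff (latticeDir i) (bandGapCoeff l α β k)) x))) := by
  refine ((tendsto_mul_bandGapGreenPartialSum h i x).const_mul _).congr fun M => ?_
  rw [inv_mul_cancel_left₀ (sub_ne_zero.2 hx.symm)]

theorem tendsto_bandGapGreen (h : ∀ p, bandGapSymbol β k (latticeFreq l α p) ≠ 0)
    {x : Plane} (hx : x ∉ latticeSingular l) :
    Tendsto (fun M => bandGapGreenPartialSum l α β k M x) atTop (𝓝 (bandGapGreen l α β k x)) := by
  obtain ⟨i, hi⟩ := notMem_latticeSingular.1 hx
  have := tendsto_bandGapGreenPartialSum h hi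
  rwa [bandGapGreen, this.limUnder_eq]

theorem one_sub_mul_bandGapGreen (h : ∀ p, bandGapSymbol β k (latticeFreq l α p) ≠ 0)
    {i : Fin 2} {x : Plane}
    (hx : planeWave (reciprocalVector l i) x ≠ 1) :
    (1 - planeWave (reciprocalVector l i) x) * bandGapGreen l α β k x =
      ((volume.real (unitCell l) : ℝ) : ℂ)⁻¹ *
        waveSeries l α (backDiff (latticeDir i) (bandGapCoeff l α β k)) x := by
  rw [bandGapGreen, (tendsto_bandGapGreenPartialSum h hx).limUnder_eq,
    mul_inv_cancel_left₀ (sub_ne_zero.2 hx.symm)]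

/-- The first factor comes from the conditionally convergent limit; the other two act on absolutely
convergent series. -/
theorem one_sub_pow_three_mul_bandGapGreen (h : ∀ p, bandGapSymbol β k (latticeFreq l α p) ≠ 0)
    {i : Fin 2} {x : Plane}
    (hx : planeWave (reciprocalVector l i) x ≠ 1) :
    (1 - planeWave (reciprocalVector l i) x) ^ 3 * bandGapGreen l α β k x =
      ((volume.real (unitCell l) : ℝ) : ℂ)⁻¹ * waveSeries l α (backDiff (latticeDir i)
        (backDiff (latticeDir i) (backDiff (latticeDir i) (bandGapCoeff l α β k)))) x := by
  rw [← one_sub_mul_waveSeries (hasDecay_backDiff_two_bandGapCoeff h _) (by norm_num),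
    ← one_sub_mul_waveSeries (hasDecay_backDiff_bandGapCoeff h _) (by norm_num),
    reciprocalPoint_latticeDir, mul_left_comm, mul_left_comm (((volume.real _ : ℝ) : ℂ)⁻¹),
    ← one_sub_mul_bandGapGreen h hx]
  ring

theorem contDiffAt_bandGapGreen (h : ∀ p, bandGapSymbol β k (latticeFreq l α p) ≠ 0)
    {x : Plane} (hx : x ∉ latticeSingular l) :
    ContDiffAt ℝ 2 (bandGapGreen l α β k) x := by
  obtain ⟨i, hi⟩ := notMem_latticeSingular.1 hx
  have hE : ContDiff ℝ 2 fun y => (1 - planeWave (reciprocalVector l i) y) ^ 3 :=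
    (contDiff_const.sub (contDiff_planeWave _)).pow 3
  have hne : ∀ᶠ y in 𝓝 x, planeWave (reciprocalVector l i) y ≠ 1 :=
    (contDiff_planeWave (n := 0) _).continuous.continuousAt.eventually_ne hi
  have hW := (contDiff_waveSeries (l := l) (α := α)
    (hasDecay_backDiff_three_bandGapCoeff h (latticeDir i)) (by norm_num)).contDiffAt (x := x)
  refine ((contDiffAt_const (c := ((volume.real (unitCell l) : ℝ) : ℂ)⁻¹)).mul hW |>.mul
    (hE.contDiffAt.inv (pow_ne_zero 3 (sub_ne_zero.2 hi.symm)))).congr_of_eventuallyEq ?_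
  filter_upwards [hne] with y hy
  rw [← one_sub_pow_three_mul_bandGapGreen h hy, mul_comm, Pi.inv_apply,
    inv_mul_cancel_left₀ (pow_ne_zero 3 (sub_ne_zero.2 hy.symm))]

theorem contDiffAt_expWeight_mul_bandGapGreen (h : ∀ p, bandGapSymbol β k (latticeFreq l α p) ≠ 0)
    {x : Plane} (hx : x ∉ latticeSingular l) :
    ContDiffAt ℝ 2 (fun y => expWeight β y * bandGapGreen l α β k y) x :=
  (contDiff_expWeight β).contDiffAt.mul (contDiffAt_bandGapGreen h hx)

/-- The conjugated Green's function solves the Helmholtz equation away from the lattice. -/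
theorem laplacian_expWeight_mul_bandGapGreen (h : ∀ p, bandGapSymbol β k (latticeFreq l α p) ≠ 0)
    {x : Plane} (hx : x ∉ latticeSingular l) :
    Laplacian.laplacian (fun y => expWeight β y * bandGapGreen l α β k y) x
      + (k : ℂ) ^ 2 * (expWeight β x * bandGapGreen l α β k x) = 0 := by
  obtain ⟨i, hi⟩ := notMem_latticeSingular.1 hx
  set e := latticeDir i with he
  set a := bandGapCoeff l α β k with ha
  set b : ℤ × ℤ → ℂ := fun p => bandGapSymbol β k (latticeFreq l α p) with hb
  set a3 := backDiff e (backDiff e (backDiff e a)) with ha3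
  have d3 : HasDecay a3 5 := hasDecay_backDiff_three_bandGapCoeff h e
  have d4 : HasDecay (backDiff e a3) 5 := d3.backDiff_self e
  have d5 : HasDecay (backDiff e (backDiff e a3)) 5 := d4.backDiff_self e
  have hE : ContDiffAt ℝ 2 (fun y => 1 - planeWave (reciprocalVector l i) y) x :=
    (contDiff_const.sub (contDiff_planeWave _)).contDiffAt
  have n3 := fun y hy => one_sub_pow_three_mul_bandGapGreen h (i := i) (x := y) hy
  rw [← he, ← ha, ← ha3] at n3
  -- One more factor is one more difference. The powers 4 and 5 are needed only as further
  -- extrapolation nodes, so keeping decay 5 is enough.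
  have shift : ∀ {c : ℤ × ℤ → ℂ} {n : ℕ}, HasDecay c 5 → (∀ y,
      planeWave (reciprocalVector l i) y ≠ 1 →
      (1 - planeWave (reciprocalVector l i) y) ^ n * bandGapGreen l α β k y =
        ((volume.real (unitCell l) : ℝ) : ℂ)⁻¹ * waveSeries l α c y) → ∀ y,
      planeWave (reciprocalVector l i) y ≠ 1 →
      (1 - planeWave (reciprocalVector l i) y) ^ (n + 1) * bandGapGreen l α β k y =
        ((volume.real (unitCell l) : ℝ) : ℂ)⁻¹ * waveSeries l α (backDiff e c) y := by
    intro c n hc hn y hy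
    rw [pow_succ', mul_assoc, hn y hy, ← one_sub_mul_waveSeries hc (by norm_num), he,
      reciprocalPoint_latticeDir]
    ring
  have n4 := shift d3 n3
  have n5 := shift d4 n4
  have L3 := laplacian_pow_mul_expWeight_mul_bandGapGreen hi d3 n3
  have L4 := laplacian_pow_mul_expWeight_mul_bandGapGreen hi d4 n4
  have L5 := laplacian_pow_mul_expWeight_mul_bandGapGreen hi d5 n5
  have key := laplacian_extrapolation hE (contDiffAt_expWeight_mul_bandGapGreen (β := β) h hx)
  have bd : ∀ {c : ℤ × ℤ → ℂ}, HasDecay c 5 → HasDecay (fun p => b p * c p) 3 := by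
    intro c hc
    have := (hasDecay_bandGapSymbol (l := l) (α := α) (β := β) (k := k)).mul hc
    norm_num at this
    exact this
  -- The powers left in the extrapolation formula become differences taken after multiplication by
  -- the symbol, the order in which `backDiff_extrapolation` needs them.
  have w3 : (1 - planeWave (reciprocalVector l i) x) ^ 2 * waveSeries l α (fun p => b p * a3 p) x =
      waveSeries l α (backDiff e (backDiff e fun p => b p * a3 p)) x := by
    rw [← one_sub_mul_waveSeries ((bd d3).backDiff_self e) (by norm_num),
      ← one_sub_mul_waveSeries (bd d3) (by norm_num), he, reciprocalPoint_latticeDir]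
    ring
  have w4 : (1 - planeWave (reciprocalVector l i) x) *
      waveSeries l α (fun p => b p * backDiff e a3 p) x =
      waveSeries l α (backDiff e fun p => b p * backDiff e a3 p) x := by
    rw [← one_sub_mul_waveSeries (bd d4) (by norm_num), he, reciprocalPoint_latticeDir]
  have wsum : 10 * waveSeries l α (backDiff e (backDiff e fun p => b p * a3 p)) x
      - 15 * waveSeries l α (backDiff e fun p => b p * backDiff e a3 p) x
      + 6 * waveSeries l α (fun p => b p * backDiff e (backDiff e a3) p) x = 0 := by
    have s3 := ((((bd d3).backDiff_self e).backDiff_self e).summable_mul_planeWave (l := l) (α := α)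
      (by norm_num) x).mul_left 10
    have s4 := (((bd d4).backDiff_self e).summable_mul_planeWave (l := l) (α := α)
      (by norm_num) x).mul_left 15
    have s5 := ((bd d5).summable_mul_planeWave (l := l) (α := α) (by norm_num) x).mul_left 6
    simp only [waveSeries]
    rw [← tsum_mul_left, ← tsum_mul_left, ← tsum_mul_left, ← s3.tsum_sub s4,
      ← (s3.sub s4).tsum_add s5]
    rw [← tsum_zero (α := ℂ) (β := ℤ × ℤ)]
    refine tsum_congr fun p => ?_
    have := backDiff_extrapolation (e := e) (bandGapSymbol_mul_bandGapCoeff h)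
      (backDiff_three_bandGapSymbol e) p
    linear_combination (planeWave (latticeFreq l α p) x) * this
  have hne : (1 - planeWave (reciprocalVector l i) x) ^ 5 ≠ 0 :=
    pow_ne_zero 5 (sub_ne_zero.2 hi.symm)
  refine (mul_eq_zero.1 ?_).resolve_left hne
  linear_combination key + 10 * (1 - planeWave (reciprocalVector l i) x) ^ 2 * L3
    - 15 * (1 - planeWave (reciprocalVector l i) x) * L4 + 6 * L5
    + ((volume.real (unitCell l) : ℝ) : ℂ)⁻¹ * expWeight β x * (10 * w3 - 15 * w4 + wsum)

/-! ### The singularity of the Green's function -/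

theorem waveSeries_backDiff_zero (h : ∀ p, bandGapSymbol β k (latticeFreq l α p) ≠ 0)
    (i : Fin 2) :
    ((volume.real (unitCell l) : ℝ) : ℂ)⁻¹ *
      waveSeries l α (backDiff (latticeDir i) (bandGapCoeff l α β k)) 0 = 0 := by
  have := tendsto_mul_bandGapGreenPartialSum h i 0
  simp only [planeWave_zero_right, sub_self, zero_mul] at this
  exact tendsto_nhds_unique this tendsto_const_nhds

/-- The differenced series vanishes at 0, so its size is its increment from 0. The exponent 3/4
leads to a kernel of order -1/4, whose cube has order -3/4 and is still integrable along curves. -/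
theorem exists_norm_waveSeries_backDiff_le (h : ∀ p, bandGapSymbol β k (latticeFreq l α p) ≠ 0)
    (i : Fin 2) :
    ∃ C : ℝ, 0 < C ∧ ∀ x, ‖((volume.real (unitCell l) : ℝ) : ℂ)⁻¹ *
      waveSeries l α (backDiff (latticeDir i) (bandGapCoeff l α β k)) x‖
        ≤ C * ‖x‖ ^ (3 / 4 : ℝ) := by
  set c := backDiff (latticeDir i) (bandGapCoeff l α β k) with hc
  set V := ((volume.real (unitCell l) : ℝ) : ℂ)⁻¹ with hV
  have hd : HasDecay c 3 := hasDecay_backDiff_bandGapCoeff h (latticeDir i)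
  obtain ⟨B, hB0, hB⟩ := hd.exists_pos
  obtain ⟨A, hA0, hA⟩ := exists_norm_latticeFreq_le l α
  set S := ∑' p, B * (2 * A ^ (3 / 4 : ℝ)) * latticeWeight p ^ (-(9 / 4) : ℝ) with hS
  have hsum : Summable fun p => B * (2 * A ^ (3 / 4 : ℝ)) * latticeWeight p ^ (-(9 / 4) : ℝ) :=
    (summable_latticeWeight_rpow (by norm_num)).mul_left _
  have hS0 : 0 ≤ S := tsum_nonneg fun p => by
    have := Real.rpow_nonneg (latticeWeight_pos p).le (-(9 / 4) : ℝ)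
    positivity
  refine ⟨‖V‖ * S + 1, by positivity, fun x => ?_⟩
  have h0 : V * waveSeries l α c 0 = 0 := waveSeries_backDiff_zero h i
  have hterm : ∀ p, ‖c p * planeWave (latticeFreq l α p) x - c p * planeWave (latticeFreq l α p) 0‖
      ≤ B * (2 * A ^ (3 / 4 : ℝ)) * latticeWeight p ^ (-(9 / 4) : ℝ) * ‖x‖ ^ (3 / 4 : ℝ) := by
    intro p
    have hw := latticeWeight_pos p
    rw [planeWave_zero_right, ← mul_sub, norm_mul]
    calc ‖c p‖ * ‖planeWave (latticeFreq l α p) x - 1‖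
        ≤ (B * latticeWeight p ^ (-3 : ℝ)) *
            (2 * ((A * latticeWeight p) * ‖x‖) ^ (3 / 4 : ℝ)) := by
          gcongr
          · exact hB p
          · refine (norm_planeWave_sub_one_le_rpow _ _).trans ?_
            gcongr
            exact hA p
      _ = _ := by
          rw [Real.mul_rpow (by positivity) (norm_nonneg _), Real.mul_rpow hA0.le hw.le,
            show (-(9 / 4) : ℝ) = -3 + 3 / 4 by norm_num, Real.rpow_add hw]
          ring
  have h1 : ‖waveSeries l α c x - waveSeries l α c 0‖ ≤ S * ‖x‖ ^ (3 / 4 : ℝ) := by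
    simp only [waveSeries]
    rw [← (hd.summable_mul_planeWave (by norm_num) x).tsum_sub
      (hd.summable_mul_planeWave (by norm_num) 0), hS, ← tsum_mul_right]
    exact tsum_of_norm_bounded (hsum.mul_right _).hasSum hterm
  calc ‖V * waveSeries l α c x‖ = ‖V * (waveSeries l α c x - waveSeries l α c 0)‖ := by
        rw [mul_sub, h0, sub_zero]
    _ ≤ ‖V‖ * (S * ‖x‖ ^ (3 / 4 : ℝ)) := by
        rw [norm_mul]
        gcongr
    _ ≤ (‖V‖ * S + 1) * ‖x‖ ^ (3 / 4 : ℝ) := by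
        have := Real.rpow_nonneg (norm_nonneg x) (3 / 4)
        nlinarith

/-- Divide by 1 - exp(i bᵢ·x) with i the larger lattice coordinate of x: that factor is bounded
below by a multiple of |x|, which turns |x|^(3/4) into |x|^(-1/4). -/
theorem exists_norm_bandGapGreen_le_of_abs_le (h : ∀ p, bandGapSymbol β k (latticeFreq l α p) ≠ 0) :
    ∃ C : ℝ, 0 < C ∧ ∀ x ∉ latticeSingular l, (∀ i, |l.repr x i| ≤ 1 / 2) →
      ‖bandGapGreen l α β k x‖ ≤ C * ‖x‖ ^ (-(1 / 4) : ℝ) := by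
  choose A hA0 hA using exists_norm_waveSeries_backDiff_le (l := l) (α := α) (β := β) (k := k) h
  set K := ‖l 0‖ + ‖l 1‖ with hK
  have hK0 : 0 < K := add_pos_of_pos_of_nonneg (norm_pos_iff.2 (l.ne_zero 0)) (norm_nonneg _)
  refine ⟨(A 0 + A 1) * K / 4, by have := hA0 0; have := hA0 1; positivity, fun x hx hxl => ?_⟩
  obtain ⟨i, hi⟩ : ∃ i, ∀ j, |l.repr x j| ≤ |l.repr x i| := Finite.exists_max _
  have hxne : x ≠ 0 := by
    rintro rfl
    exact hx fun i => planeWave_zero_right _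
  have hx0 : 0 < ‖x‖ := norm_pos_iff.2 hxne
  have h1 : ‖x‖ ≤ K * |l.repr x i| := by
    calc ‖x‖ = ‖l.repr x 0 • l 0 + l.repr x 1 • l 1‖ := by
          conv_lhs => rw [← l.sum_repr x, Fin.sum_univ_two]
      _ ≤ |l.repr x 0| * ‖l 0‖ + |l.repr x 1| * ‖l 1‖ := by
          refine (norm_add_le _ _).trans_eq ?_
          rw [norm_smul, norm_smul, Real.norm_eq_abs, Real.norm_eq_abs]
      _ ≤ |l.repr x i| * ‖l 0‖ + |l.repr x i| * ‖l 1‖ := by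
          exact add_le_add (mul_le_mul_of_nonneg_right (hi 0) (norm_nonneg _))
            (mul_le_mul_of_nonneg_right (hi 1) (norm_nonneg _))
      _ = _ := by rw [hK]; ring
  have hci : 0 < |l.repr x i| := by
    by_contra hcon
    have : K * |l.repr x i| ≤ 0 := mul_nonpos_of_nonneg_of_nonpos hK0.le (not_lt.1 hcon)
    linarith
  have h2 := four_mul_abs_le_norm_one_sub_planeWave (hxl i)
  have hne : planeWave (reciprocalVector l i) x ≠ 1 := by
    intro heq
    rw [heq, sub_self, norm_zero] at h2
    linarith
  have h3 := hA i x
  rw [← one_sub_mul_bandGapGreen h hne, norm_mul] at h3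
  have hAi : A i ≤ A 0 + A 1 := by
    have := (hA0 0).le
    have := (hA0 1).le
    fin_cases i <;> simpa
  have h4 : 4 * ‖x‖ / K ≤ ‖1 - planeWave (reciprocalVector l i) x‖ := by
    rw [div_le_iff₀ hK0]
    nlinarith
  have h5 : 4 * ‖x‖ / K * ‖bandGapGreen l α β k x‖ ≤ (A 0 + A 1) * ‖x‖ ^ (3 / 4 : ℝ) := by
    calc 4 * ‖x‖ / K * ‖bandGapGreen l α β k x‖
        ≤ ‖1 - planeWave (reciprocalVector l i) x‖ * ‖bandGapGreen l α β k x‖ := by gcongr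
      _ ≤ A i * ‖x‖ ^ (3 / 4 : ℝ) := h3
      _ ≤ _ := by gcongr
  have h6 : ‖x‖ ^ (3 / 4 : ℝ) = ‖x‖ * ‖x‖ ^ (-(1 / 4) : ℝ) := by
    nth_rw 2 [← Real.rpow_one ‖x‖]
    rw [← Real.rpow_add hx0]
    norm_num
  rw [h6] at h5
  rw [div_mul_eq_mul_div, div_le_iff₀ hK0] at h5
  have h7 : ‖x‖ * ‖bandGapGreen l α β k x‖ ≤
      ‖x‖ * ((A 0 + A 1) * K / 4 * ‖x‖ ^ (-(1 / 4) : ℝ)) := by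
    linarith
  exact le_of_mul_le_mul_left h7 hx0

/-- Each partial sum is quasi-periodic with the unimodular factor exp(iα·ℓ), and so is the limit. -/
theorem norm_bandGapGreen_add_lattice (h : ∀ p, bandGapSymbol β k (latticeFreq l α p) ≠ 0)
    {x : Plane} (m : Fin 2 → ℤ) (hx : x ∉ latticeSingular l) :
    ‖bandGapGreen l α β k (x + ∑ i, (m i : ℝ) • l i)‖ = ‖bandGapGreen l α β k x‖ := by
  set ℓ := ∑ i, (m i : ℝ) • l i with hℓ
  have h1 : ∀ M, bandGapGreenPartialSum l α β k M (x + ℓ) =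
      planeWave α ℓ * bandGapGreenPartialSum l α β k M x := by
    intro M
    rw [bandGapGreenPartialSum_eq, bandGapGreenPartialSum_eq, mul_left_comm,
      Finset.mul_sum _ _ (planeWave α ℓ)]
    congr 1
    refine Finset.sum_congr rfl fun p _ => ?_
    rw [planeWave_add_right]
    nth_rw 2 [latticeFreq]
    rw [planeWave_add, planeWave_reciprocalPoint_add_lattice]
    ring
  have h2 : bandGapGreen l α β k (x + ℓ) = planeWave α ℓ * bandGapGreen l α β k x := by
    have := (tendsto_bandGapGreen h hx).const_mul (planeWave α ℓ)
    simp only [← h1] at this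
    exact this.limUnder_eq
  rw [h2, norm_mul, norm_planeWave, one_mul]

/-- The Green's function is `O(|x - ℓ| ^ (-1/4))` near each lattice point `ℓ`. -/
theorem exists_norm_bandGapGreen_le (h : ∀ p, bandGapSymbol β k (latticeFreq l α p) ≠ 0) :
    ∃ C : ℝ, 0 < C ∧ ∀ x ∉ latticeSingular l,
      ‖bandGapGreen l α β k x‖ ≤
        C * ‖x - ∑ i : Fin 2, (round (l.repr x i) : ℝ) • l i‖ ^ (-(1 / 4) : ℝ) := by
  obtain ⟨C, hC0, hC⟩ := exists_norm_bandGapGreen_le_of_abs_le (l := l) (α := α) (β := β) (k := k) h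
  refine ⟨C, hC0, fun x hx => ?_⟩
  set m : Fin 2 → ℤ := fun i => round (l.repr x i)
  have hr : ∀ i, l.repr (x - ∑ i : Fin 2, (m i : ℝ) • l i) i = l.repr x i - m i := by
    intro i
    fin_cases i <;> simp [Fin.sum_univ_two]
  have hx' : x - ∑ i : Fin 2, (m i : ℝ) • l i ∉ latticeSingular l := by
    intro hcon
    refine hx fun i => ?_
    obtain ⟨n, hn⟩ := (planeWave_reciprocalVector_eq_one_iff i _).1 (hcon i)
    rw [hr] at hn
    refine (planeWave_reciprocalVector_eq_one_iff i _).2 ⟨n + m i, ?_⟩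
    push_cast
    linarith
  have h1 := hC _ hx' fun i => by
    rw [hr]
    exact abs_sub_round _
  rwa [← norm_bandGapGreen_add_lattice h m hx', sub_add_cancel] at h1

end Green

/-! ### Riesz potentials of the arc length measure -/

theorem lintegral_ball_enorm_rpow_lt_top :
    ∫⁻ u in Metric.ball (0 : ℝ) 1, ‖u‖ₑ ^ (-(3 / 4) : ℝ) < ⊤ := by
  have h : IntegrableOn (fun u : ℝ => ‖u‖ ^ (-(3 / 4) : ℝ)) (Metric.ball 0 1) := by
    refine integrableOn_ball_of_norm_le_rpow (α := 3 / 4) (C := 1) (by simp) (by simp; norm_num)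
      (Eventually.of_forall fun x => ?_) ?_
    · rw [one_mul, Real.norm_of_nonneg (Real.rpow_nonneg (norm_nonneg _) _)]
    · exact (measurable_norm.pow_const _).aestronglyMeasurable
  refine lt_of_eq_of_lt (lintegral_congr_ae ?_) h.2
  -- At u = 0 the real power is 0 by default and the extended one is ∞; the two agree off this null
  -- set.
  have h0 : ∀ᵐ u : ℝ, u ≠ 0 := by simp [ae_iff]
  filter_upwards [ae_restrict_of_ae h0] with u hu
  rw [Real.enorm_of_nonneg (Real.rpow_nonneg (norm_nonneg _) _), ← ofReal_norm,
    ENNReal.ofReal_rpow_of_pos (norm_pos_iff.2 hu)]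

theorem ENNReal.rpow_neg_antitone {r : ℝ} (hr : 0 ≤ r) {a b : ENNReal} (h : a ≤ b) :
    b ^ (-r) ≤ a ^ (-r) := by
  rw [ENNReal.rpow_neg, ENNReal.rpow_neg]
  exact ENNReal.inv_le_inv.2 (ENNReal.rpow_le_rpow h hr)

/-- Within distance 1 of c the singular integral is translation invariant; beyond it the integrand
is at most 1. The bound is therefore uniform in c. -/
theorem exists_lintegral_Icc_edist_rpow_le (a b : ℝ) :
    ∃ K : ENNReal, K < ⊤ ∧ ∀ c : ℝ, ∫⁻ t in Icc a b, edist c t ^ (-(3 / 4) : ℝ) ≤ K := by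
  set f : ℝ → ENNReal := (Metric.ball (0 : ℝ) 1).indicator fun u => ‖u‖ₑ ^ (-(3 / 4) : ℝ)
    with hf
  refine ⟨(∫⁻ u, f u) + volume (Icc a b), ?_, fun c => ?_⟩
  · rw [hf, lintegral_indicator Metric.isOpen_ball.measurableSet]
    exact ENNReal.add_lt_top.2 ⟨lintegral_ball_enorm_rpow_lt_top, by simp⟩
  · have hfm : Measurable f :=
      (measurable_enorm.pow_const _).indicator Metric.isOpen_ball.measurableSet
    have hpt : ∀ t, edist c t ^ (-(3 / 4) : ℝ) ≤ f (c - t) + 1 := by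
      intro t
      rw [edist_eq_enorm_sub]
      by_cases h : c - t ∈ Metric.ball (0 : ℝ) 1
      · rw [hf, indicator_of_mem h]
        exact le_self_add
      · refine le_add_left ?_
        have h1 : (1 : ENNReal) ≤ ‖c - t‖ₑ := by
          rw [Metric.mem_ball, dist_zero_right, not_lt] at h
          rw [← ofReal_norm]
          simpa using ENNReal.ofReal_le_ofReal h
        simpa using ENNReal.rpow_neg_antitone (by norm_num : (0 : ℝ) ≤ 3 / 4) h1
    calc ∫⁻ t in Icc a b, edist c t ^ (-(3 / 4) : ℝ)
        ≤ ∫⁻ t in Icc a b, (f (c - t) + 1) := lintegral_mono hpt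
      _ = (∫⁻ t in Icc a b, f (c - t)) + volume (Icc a b) := by
          rw [lintegral_add_right _ measurable_const]
          simp
      _ ≤ (∫⁻ t, f (c - t)) + volume (Icc a b) := by
          gcongr
          exact Measure.restrict_le_self
      _ = _ := by rw [lintegral_sub_left_eq_self f c]

/-- The set `S` has finite length and its arc length has a bounded Riesz potential of order
`-3/4`. -/
def HasBoundedPotential (S : Set Plane) : Prop :=
  Measure.hausdorffMeasure 1 S < ⊤ ∧ ∃ C : ENNReal, C < ⊤ ∧ ∀ x : Plane,
    ∫⁻ y in S, edist x y ^ (-(3 / 4) : ℝ) ∂(Measure.hausdorffMeasure 1) ≤ C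

theorem HasBoundedPotential.empty : HasBoundedPotential ∅ :=
  ⟨by simp, 0, by simp, by simp⟩

theorem HasBoundedPotential.mono {S T : Set Plane} (h : S ⊆ T) (hT : HasBoundedPotential T) :
    HasBoundedPotential S := by
  obtain ⟨h1, C, hC, h2⟩ := hT
  exact ⟨(measure_mono h).trans_lt h1, C, hC, fun x => (lintegral_mono_set h).trans (h2 x)⟩

theorem HasBoundedPotential.union {S T : Set Plane} (hS : HasBoundedPotential S)
    (hT : HasBoundedPotential T) : HasBoundedPotential (S ∪ T) := by
  obtain ⟨h1, C, hC, h2⟩ := hS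
  obtain ⟨h1', C', hC', h2'⟩ := hT
  exact ⟨(measure_union_le S T).trans_lt (ENNReal.add_lt_top.2 ⟨h1, h1'⟩), C + C',
    ENNReal.add_lt_top.2 ⟨hC, hC'⟩,
    fun x => (lintegral_union_le _ S T).trans (add_le_add (h2 x) (h2' x))⟩

theorem HasBoundedPotential.iUnion {ι : Type*} [Finite ι] {S : ι → Set Plane}
    (hS : ∀ i, HasBoundedPotential (S i)) : HasBoundedPotential (⋃ i, S i) := by
  have h : ∀ s : Finset ι, HasBoundedPotential (⋃ i ∈ s, S i) := by
    classical
    intro s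
    induction s using Finset.induction_on with
    | empty => simpa using HasBoundedPotential.empty
    | insert i s _ ih =>
      rw [Finset.set_biUnion_insert]
      exact (hS i).union ih
  have := Fintype.ofFinite ι
  simpa using h Finset.univ

/-- A set that projects bi-Lipschitzly to an interval has a bounded Riesz potential. -/
theorem HasBoundedPotential.of_projection {S : Set Plane} {π : Plane → ℝ} (hπ : LipschitzWith 1 π)
    {K : ℝ≥0} {a b : ℝ} {γ : ℝ → Plane} (hγ : LipschitzOnWith K γ (Icc a b))
    (hS : ∀ y ∈ S, π y ∈ Icc a b ∧ γ (π y) = y) : HasBoundedPotential S := by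
  have hsub : ∀ A : Set ℝ, Measure.hausdorffMeasure 1 (π ⁻¹' A ∩ S) ≤ K * volume (A ∩ Icc a b) := by
    intro A
    have h1 : π ⁻¹' A ∩ S ⊆ γ '' (A ∩ Icc a b) := fun y hy =>
      ⟨π y, ⟨hy.1, (hS y hy.2).1⟩, (hS y hy.2).2⟩
    refine (measure_mono h1).trans ?_
    have := (hγ.mono inter_subset_right : LipschitzOnWith K γ (A ∩ Icc a b)).hausdorffMeasure_image_le
      zero_le_one
    rwa [ENNReal.rpow_one, hausdorffMeasure_real] at this
  -- Pushed to the line, arc length is at most K times Lebesgue measure; as π does not increase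
  -- distances, the planar potential is controlled by the one-dimensional one.
  have hmap : ((Measure.hausdorffMeasure 1).restrict S).map π ≤
      (K : ENNReal) • volume.restrict (Icc a b) := by
    refine Measure.le_iff.2 fun A hA => ?_
    rw [Measure.map_apply hπ.continuous.measurable hA,
      Measure.restrict_apply (hπ.continuous.measurable hA), Measure.smul_apply,
      Measure.restrict_apply hA, smul_eq_mul]
    exact hsub A
  obtain ⟨C, hC, hC'⟩ := exists_lintegral_Icc_edist_rpow_le a b
  refine ⟨?_, K * C, ENNReal.mul_lt_top ENNReal.coe_lt_top hC, fun x => ?_⟩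
  · have := hsub univ
    rw [preimage_univ, univ_inter, univ_inter] at this
    exact this.trans_lt (ENNReal.mul_lt_top ENNReal.coe_lt_top (by simp))
  · have hm : Measurable fun t : ℝ => edist (π x) t ^ (-(3 / 4) : ℝ) :=
      (measurable_const.edist measurable_id).pow_const _
    calc ∫⁻ y in S, edist x y ^ (-(3 / 4) : ℝ) ∂(Measure.hausdorffMeasure 1)
        ≤ ∫⁻ y in S, edist (π x) (π y) ^ (-(3 / 4) : ℝ) ∂(Measure.hausdorffMeasure 1) := by
          refine lintegral_mono fun y => ENNReal.rpow_neg_antitone (by norm_num) ?_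
          simpa using hπ.edist_le_mul x y
      _ = ∫⁻ t, edist (π x) t ^ (-(3 / 4) : ℝ)
            ∂(((Measure.hausdorffMeasure 1).restrict S).map π) :=
          (lintegral_map hm hπ.continuous.measurable).symm
      _ ≤ ∫⁻ t, edist (π x) t ^ (-(3 / 4) : ℝ) ∂((K : ENNReal) • volume.restrict (Icc a b)) :=
          lintegral_mono' hmap le_rfl
      _ = K * ∫⁻ t in Icc a b, edist (π x) t ^ (-(3 / 4) : ℝ) := by
          rw [lintegral_smul_measure, smul_eq_mul]
      _ ≤ K * C := by gcongr; exact hC' _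

/-! ### Boundaries that are locally graphs -/

theorem contDiff_plane_mk {f g : ℝ → ℝ} (hf : ContDiff ℝ 1 f) (hg : ContDiff ℝ 1 g) :
    ContDiff ℝ 1 fun t : ℝ => (!₂[f t, g t] : Plane) := by
  rw [contDiff_euclidean]
  intro i
  fin_cases i
  exacts [hf, hg]

/-- The boundary of an open set of class `C^{1,s}` is locally part of the graph. -/
theorem eq_of_mem_frontier_of_eventually {Ω : Set Plane} {T : Plane ≃ᵢ Plane} {g : ℝ → ℝ}
    (hg : Continuous g) {y : Plane} (hy : y ∈ frontier Ω)
    (h : ∀ᶠ z in 𝓝 y, (z ∈ Ω ↔ g (T z 0) < T z 1)) : g (T y 0) = T y 1 := by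
  have hc0 : Continuous fun z => g (T z 0) :=
    hg.comp ((EuclideanSpace.proj (𝕜 := ℝ) (0 : Fin 2)).continuous.comp T.continuous)
  have hc1 : Continuous fun z => T z 1 :=
    (EuclideanSpace.proj (𝕜 := ℝ) (1 : Fin 2)).continuous.comp T.continuous
  refine le_antisymm ?_ ?_
  · by_contra hlt
    rw [not_le] at hlt
    have h1 : ∀ᶠ z in 𝓝 y, z ∉ Ω := by
      filter_upwards [h, hc1.continuousAt.eventually_lt hc0.continuousAt hlt] with z hz hz'
      rw [hz]
      exact hz'.not_gt
    exact (mem_closure_iff_frequently.1 hy.1) h1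
  · by_contra hlt
    rw [not_le] at hlt
    refine hy.2 (mem_interior_iff_mem_nhds.2 ?_)
    filter_upwards [h, hc0.continuousAt.eventually_lt hc1.continuousAt hlt] with z hz hz'
    exact hz.2 hz'

theorem lipschitzWith_chart (T : Plane ≃ᵢ Plane) : LipschitzWith 1 fun y => T y 0 := by
  refine LipschitzWith.mk_one fun x y => ?_
  rw [← T.dist_eq x y, dist_eq_norm, dist_eq_norm]
  exact PiLp.norm_apply_le (T x - T y) 0

/-- Locally the boundary lies on a C¹ graph, which is Lipschitz over a compact interval and is
inverted by the first chart coordinate. Compactness reduces the claim to such pieces. -/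
theorem HasC1HolderBoundary.hasBoundedPotential {s : ℝ≥0} {Ω : Set Plane}
    (h : HasC1HolderBoundary s Ω) (hc : IsCompact (frontier Ω)) :
    HasBoundedPotential (frontier Ω) := by
  refine hc.induction_on HasBoundedPotential.empty (fun S T hST hT => hT.mono hST)
    (fun S T hS hT => hS.union hT) fun p hp => ?_
  obtain ⟨T, g, C, hg, -, hT⟩ := h p hp
  obtain ⟨r, hr, hball⟩ := Metric.eventually_nhds_iff_ball.1 hT
  refine ⟨frontier Ω ∩ Metric.ball p r,
    inter_mem self_mem_nhdsWithin (mem_nhdsWithin_of_mem_nhds (Metric.ball_mem_nhds p hr)), ?_⟩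
  have hcurve : ContDiff ℝ 1 fun t : ℝ => (!₂[t, g t] : Plane) :=
    contDiff_plane_mk contDiff_id hg
  obtain ⟨K, hK⟩ := LocallyLipschitzOn.exists_lipschitzOnWith_of_compact
    (isCompact_Icc (a := T p 0 - r) (b := T p 0 + r)) hcurve.locallyLipschitz.locallyLipschitzOn
  have hγ : LipschitzOnWith K (fun t => T.symm (!₂[t, g t])) (Icc (T p 0 - r) (T p 0 + r)) := by
    have := T.symm.isometry.lipschitz.comp_lipschitzOnWith hK
    rwa [one_mul] at this
  refine HasBoundedPotential.of_projection (lipschitzWith_chart T) hγ fun y hy => ⟨?_, ?_⟩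
  · have h1 := (lipschitzWith_chart T).dist_le_mul y p
    rw [NNReal.coe_one, one_mul, Real.dist_eq] at h1
    have h2 := abs_le.1 (h1.trans (Metric.mem_ball.1 hy.2).le)
    exact ⟨by linarith [h2.1], by linarith [h2.2]⟩
  · have h1 : ∀ᶠ z in 𝓝 y, (z ∈ Ω ↔ g (T z 0) < T z 1) :=
      eventually_of_mem (Metric.isOpen_ball.mem_nhds hy.2) hball
    have h2 := eq_of_mem_frontier_of_eventually hg.continuous hy.1 h1
    rw [T.symm_apply_eq]
    ext i
    fin_cases i
    · simp
    · simpa using h2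

/-- Every neighbourhood of a boundary point carries positive arc length. -/
theorem HasC1HolderBoundary.hausdorffMeasure_pos {s : ℝ≥0} {Ω : Set Plane} (hΩ : IsOpen Ω)
    (h : HasC1HolderBoundary s Ω) {p : Plane} (hp : p ∈ frontier Ω) {U : Set Plane}
    (hU : U ∈ 𝓝 p) : 0 < Measure.hausdorffMeasure 1 (frontier Ω ∩ U) := by
  obtain ⟨T, g, C, hg, -, hT⟩ := h p hp
  have hcurve : Continuous fun t : ℝ => T.symm (!₂[t, g t]) := by
    refine T.symm.continuous.comp ?_
    exact (contDiff_plane_mk contDiff_id hg).continuous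
  have hpγ : T.symm (!₂[T p 0, g (T p 0)]) = p := by
    have h2 := eq_of_mem_frontier_of_eventually hg.continuous hp hT
    rw [T.symm_apply_eq]
    ext i
    fin_cases i
    · simp
    · simpa using h2
  have hev : ∀ᶠ t in 𝓝 (T p 0), T.symm (!₂[t, g t]) ∈ frontier Ω ∩ U := by
    have h1 : Tendsto (fun t : ℝ => T.symm (!₂[t, g t])) (𝓝 (T p 0)) (𝓝 p) := by
      have := hcurve.tendsto (T p 0)
      rwa [hpγ] at this
    filter_upwards [h1.eventually hU, h1.eventually hT.eventually_nhds] with t ht ht'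
    refine ⟨?_, ht⟩
    rw [hΩ.frontier_eq]
    refine ⟨?_, ?_⟩
    · have hup : Continuous fun τ : ℝ => T.symm (!₂[t, g t + τ]) := by
        refine T.symm.continuous.comp ?_
        exact (contDiff_plane_mk contDiff_const (contDiff_const.add contDiff_id)).continuous
      have h3 : Tendsto (fun τ : ℝ => T.symm (!₂[t, g t + τ])) (𝓝[>] 0)
          (𝓝 (T.symm (!₂[t, g t]))) := by
        have := hup.tendsto 0
        rw [add_zero] at this
        exact this.mono_left nhdsWithin_le_nhds
      refine mem_closure_of_tendsto h3 ?_
      filter_upwards [h3.eventually ht', self_mem_nhdsWithin] with τ hτ hτ0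
      rw [hτ]
      simpa using hτ0
    · rw [ht'.self_of_nhds]
      simp
  -- The first chart coordinate maps the piece of boundary onto a neighbourhood in ℝ without
  -- increasing length.
  have hpos : 0 < volume ((fun y => T y 0) '' (frontier Ω ∩ U)) := by
    refine Measure.measure_pos_of_mem_nhds volume (x := T p 0) ?_
    filter_upwards [hev] with t ht
    exact ⟨_, ht, by simp⟩
  have hle := (lipschitzWith_chart T).hausdorffMeasure_image_le zero_le_one (frontier Ω ∩ U)
  rw [hausdorffMeasure_real] at hle
  simpa using hpos.trans_le hle

/-! ### Continuity of potentials with weakly singular kernels -/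

section Continuity

variable {σ : Measure Plane} {G : Plane → ℂ} {Z : Set Plane}

theorem aestronglyMeasurable_kernel (hZ : IsClosed Z) (hG : ContinuousOn G Zᶜ) {x : Plane}
    (hx : ∀ᵐ y ∂σ, x - y ∉ Z) : AEStronglyMeasurable (fun y => G (x - y)) σ := by
  have hc : Continuous fun y : Plane => x - y := continuous_const.sub continuous_id
  have ho : IsOpen {y | x - y ∉ Z} := hZ.isOpen_compl.preimage hc
  rw [← Measure.restrict_eq_self_of_ae_mem hx]
  exact (hG.comp hc.continuousOn fun y hy => hy).aestronglyMeasurable ho.measurableSet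

/-- The value `z`, truncated to modulus at most `K`. -/
def truncateNorm (K : ℝ) (z : ℂ) : ℂ := z * ((K / max K ‖z‖ : ℝ) : ℂ)

theorem continuous_truncateNorm {K : ℝ} (hK : 0 < K) : Continuous (truncateNorm K) := by
  unfold truncateNorm
  refine continuous_id.mul (Complex.continuous_ofReal.comp ?_)
  exact continuous_const.div (continuous_const.max continuous_norm)
    fun z => (lt_max_of_lt_left hK).ne'

theorem norm_truncateNorm_le {K : ℝ} (hK : 0 < K) (z : ℂ) : ‖truncateNorm K z‖ ≤ K := by
  have hm : 0 < max K ‖z‖ := lt_max_of_lt_left hK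
  rw [truncateNorm, norm_mul, Complex.norm_real, Real.norm_of_nonneg (by positivity),
    mul_div_assoc', div_le_iff₀ hm, mul_comm]
  gcongr
  exact le_max_right _ _

/-- The difference is nonzero only where ‖z‖ > j². There j‖z‖‖w‖ ≤ (j²‖z‖² + ‖w‖²)/2, and j²‖z‖² ≤
‖z‖³. -/
theorem norm_sub_truncateNorm_mul_le {j : ℝ} (hj : 0 < j) (z w : ℂ) :
    ‖z * w - truncateNorm (j ^ 2) z * w‖ ≤ (‖z‖ ^ 3 + ‖w‖ ^ 2) / j := by
  rcases le_total ‖z‖ (j ^ 2) with h | h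
  · rw [truncateNorm, max_eq_left h, div_self (by positivity)]
    simp only [Complex.ofReal_one, mul_one, sub_self, norm_zero]
    positivity
  · have hz : 0 < ‖z‖ := lt_of_lt_of_le (by positivity) h
    have h1 : ‖z - truncateNorm (j ^ 2) z‖ ≤ ‖z‖ := by
      have h2 : z - truncateNorm (j ^ 2) z = z * ((1 - j ^ 2 / ‖z‖ : ℝ) : ℂ) := by
        rw [truncateNorm, max_eq_right h]
        push_cast
        ring
      have h3 : j ^ 2 / ‖z‖ ≤ 1 := (div_le_one hz).2 h
      have h4 : 0 ≤ j ^ 2 / ‖z‖ := by positivity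
      rw [h2, norm_mul, Complex.norm_real, Real.norm_of_nonneg (by linarith)]
      nlinarith
    rw [← sub_mul, norm_mul, le_div_iff₀ hj]
    calc ‖z - truncateNorm (j ^ 2) z‖ * ‖w‖ * j ≤ ‖z‖ * ‖w‖ * j := by gcongr
      _ ≤ (j ^ 2 * ‖z‖ ^ 2 + ‖w‖ ^ 2) / 2 := by nlinarith [sq_nonneg (j * ‖z‖ - ‖w‖)]
      _ ≤ ‖z‖ ^ 3 + ‖w‖ ^ 2 := by
        have : j ^ 2 * ‖z‖ ^ 2 ≤ ‖z‖ * ‖z‖ ^ 2 := by gcongr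
        nlinarith [sq_nonneg ‖w‖, pow_pos hz 3]

/-- A potential whose kernel is bounded in `L³` and whose density is in `L²` is continuous. -/
theorem continuousOn_potential [IsFiniteMeasure σ] (hZ : IsClosed Z) (hG : ContinuousOn G Zᶜ)
    {S : Set Plane} (hae : ∀ x, ∀ᵐ y ∂σ, x - y ∉ Z) {M : ENNReal} (hM : M < ⊤)
    (hb : ∀ x ∈ S, ∫⁻ y, ‖G (x - y)‖ₑ ^ 3 ∂σ ≤ M) {φ : Plane → ℂ} (hφ : MemLp φ 2 σ) :
    ContinuousOn (fun x => ∫ y, G (x - y) * φ y ∂σ) S := by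
  have hmeas : ∀ x, AEStronglyMeasurable (fun y => G (x - y)) σ := fun x =>
    aestronglyMeasurable_kernel hZ hG (hae x)
  have hφ1 : Integrable φ σ := hφ.integrable (by norm_num)
  have hφ2 : Integrable (fun y => ‖φ y‖ ^ 2) σ := by
    simpa using hφ.integrable_norm_pow (by norm_num)
  have hG3 : ∀ x ∈ S, Integrable (fun y => ‖G (x - y)‖ ^ 3) σ ∧
      ∫ y, ‖G (x - y)‖ ^ 3 ∂σ ≤ M.toReal := by
    intro x hx
    have he : ∫⁻ y, ‖‖G (x - y)‖ ^ 3‖ₑ ∂σ = ∫⁻ y, ‖G (x - y)‖ₑ ^ 3 ∂σ := by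
      simp only [enorm_pow, enorm_norm]
    refine ⟨⟨(hmeas x).norm.pow 3, ?_⟩, ?_⟩
    · rw [HasFiniteIntegral, he]
      exact (hb x hx).trans_lt hM
    · have hm3 : AEStronglyMeasurable (fun y => ‖G (x - y)‖ ^ 3) σ := (hmeas x).norm.pow 3
      have hnn : ∀ y, 0 ≤ ‖G (x - y)‖ ^ 3 := fun y => pow_nonneg (norm_nonneg _) 3
      rw [integral_eq_lintegral_of_nonneg_ae (Eventually.of_forall hnn) hm3]
      refine ENNReal.toReal_mono hM.ne (le_trans (le_of_eq ?_) (hb x hx))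
      refine lintegral_congr fun y => ?_
      rw [ENNReal.ofReal_pow (norm_nonneg _), ofReal_norm]
  have hint : ∀ x ∈ S, Integrable (fun y => G (x - y) * φ y) σ := by
    intro x hx
    refine (((integrable_const (1 : ℝ)).add (hG3 x hx).1).add hφ2).mono'
      ((hmeas x).mul hφ1.1) (Eventually.of_forall fun y => ?_)
    simp only [norm_mul, Pi.add_apply]
    have h0 := norm_nonneg (G (x - y))
    have h1 : ‖G (x - y)‖ ^ 2 ≤ 1 + ‖G (x - y)‖ ^ 3 := by
      rcases le_total ‖G (x - y)‖ 1 with h | h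
      · nlinarith [pow_nonneg h0 3]
      · nlinarith [mul_le_mul_of_nonneg_left h (sq_nonneg ‖G (x - y)‖)]
    nlinarith [sq_nonneg (‖G (x - y)‖ - ‖φ y‖), pow_nonneg h0 3]
  have hmeasT : ∀ (j : ℕ) (x : Plane), AEStronglyMeasurable
      (fun y => truncateNorm (((j : ℝ) + 1) ^ 2) (G (x - y)) * φ y) σ := fun j x =>
    ((continuous_truncateNorm (by positivity)).comp_aestronglyMeasurable (hmeas x)).mul hφ1.1
  have hboundT : ∀ (j : ℕ) (x y : Plane),
      ‖truncateNorm (((j : ℝ) + 1) ^ 2) (G (x - y)) * φ y‖ ≤ ((j : ℝ) + 1) ^ 2 * ‖φ y‖ := by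
    intro j x y
    rw [norm_mul]
    gcongr
    exact norm_truncateNorm_le (by positivity) _
  -- Bounded kernels give continuous potentials by dominated convergence. The truncation error is at
  -- most B/(j + 1) uniformly on S, so continuity passes to the limit.
  have hT : ∀ j : ℕ, Continuous fun x =>
      ∫ y, truncateNorm (((j : ℝ) + 1) ^ 2) (G (x - y)) * φ y ∂σ := by
    intro j
    rw [continuous_iff_continuousAt]
    intro x
    refine continuousAt_of_dominated (Eventually.of_forall (hmeasT j))
      (Eventually.of_forall fun x => Eventually.of_forall (hboundT j x)) (hφ1.norm.const_mul _) ?_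
    filter_upwards [hae x] with y hy
    have h1 : ContinuousAt (fun x => G (x - y)) x :=
      ContinuousAt.comp (f := fun x => x - y) (hG.continuousAt (hZ.isOpen_compl.mem_nhds hy))
        (continuous_id.sub continuous_const).continuousAt
    exact ((continuous_truncateNorm (by positivity)).continuousAt.comp h1).mul continuousAt_const
  set B := M.toReal + ∫ y, ‖φ y‖ ^ 2 ∂σ with hB
  have hunif : TendstoUniformlyOn
      (fun (j : ℕ) x => ∫ y, truncateNorm (((j : ℝ) + 1) ^ 2) (G (x - y)) * φ y ∂σ)
      (fun x => ∫ y, G (x - y) * φ y ∂σ) atTop S := by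
    rw [Metric.tendstoUniformlyOn_iff]
    intro ε hε
    have hlim : Tendsto (fun j : ℕ => B / ((j : ℝ) + 1)) atTop (𝓝 0) :=
      tendsto_const_nhds.div_atTop
        (tendsto_atTop_add_const_right _ _ tendsto_natCast_atTop_atTop)
    filter_upwards [hlim.eventually (gt_mem_nhds hε)] with j hj x hx
    refine lt_of_le_of_lt ?_ hj
    have hintT : Integrable (fun y => truncateNorm (((j : ℝ) + 1) ^ 2) (G (x - y)) * φ y) σ :=
      (hφ1.norm.const_mul _).mono' (hmeasT j x) (Eventually.of_forall (hboundT j x))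
    rw [dist_eq_norm, ← integral_sub (hint x hx) hintT]
    calc ‖∫ y, (G (x - y) * φ y - truncateNorm (((j : ℝ) + 1) ^ 2) (G (x - y)) * φ y) ∂σ‖
        ≤ ∫ y, (‖G (x - y)‖ ^ 3 + ‖φ y‖ ^ 2) / ((j : ℝ) + 1) ∂σ :=
          norm_integral_le_of_norm_le (((hG3 x hx).1.add hφ2).div_const _)
            (Eventually.of_forall fun y => norm_sub_truncateNorm_mul_le (by positivity) _ _)
      _ = (∫ y, ‖G (x - y)‖ ^ 3 ∂σ + ∫ y, ‖φ y‖ ^ 2 ∂σ) / ((j : ℝ) + 1) := by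
          rw [integral_div, integral_add (hG3 x hx).1 hφ2]
      _ ≤ B / ((j : ℝ) + 1) := by
          rw [hB]
          gcongr
          exact (hG3 x hx).2
  exact hunif.continuousOn (Frequently.of_forall fun j => (hT j).continuousOn)

end Continuity

/-! ### Potentials inside the domain -/

section CompactKernel

variable {F : Type*} [NormedAddCommGroup F] [NormedSpace ℂ F]
  {σ : Measure Plane} {ψ : Plane → ℂ} {g : Plane → F}

theorem integrable_smul_sub_of_hasCompactSupport (hψ : Integrable ψ σ) (hg : Continuous g)
    (hcg : HasCompactSupport g) (x : Plane) : Integrable (fun y => ψ y • g (x - y)) σ := by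
  obtain ⟨C, hC⟩ := hg.bounded_above_of_compact_support hcg
  refine (hψ.norm.mul_const C).mono'
    (hψ.1.smul (hg.comp (continuous_const.sub continuous_id)).aestronglyMeasurable)
    (Eventually.of_forall fun y => ?_)
  rw [norm_smul]
  gcongr
  exact hC _

theorem hasFDerivAt_integral_smul_sub [NormedSpace ℝ F] [SMulCommClass ℝ ℂ F] (hψ : Integrable ψ σ) (hg : ContDiff ℝ 1 g)
    (hcg : HasCompactSupport g) (x : Plane) :
    HasFDerivAt (fun x => ∫ y, ψ y • g (x - y) ∂σ) (∫ y, ψ y • fderiv ℝ g (x - y) ∂σ) x := by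
  have hg' : Continuous (fderiv ℝ g) := hg.continuous_fderiv (by norm_num)
  obtain ⟨C, hC⟩ := hg'.bounded_above_of_compact_support (hcg.fderiv ℝ)
  refine hasFDerivAt_integral_of_dominated_of_fderiv_le (s := univ)
    (F' := fun x y => ψ y • fderiv ℝ g (x - y)) (bound := fun y => ‖ψ y‖ * C) univ_mem
    (Eventually.of_forall fun x' =>
      (integrable_smul_sub_of_hasCompactSupport hψ hg.continuous hcg x').1)
    (integrable_smul_sub_of_hasCompactSupport hψ hg.continuous hcg x)
    (integrable_smul_sub_of_hasCompactSupport hψ hg' (hcg.fderiv ℝ) x).1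
    (Eventually.of_forall fun y x' _ => ?_) (hψ.norm.mul_const C)
    (Eventually.of_forall fun y x' _ => ?_)
  · rw [norm_smul]
    gcongr
    exact hC _
  · exact ((hg.differentiable (by norm_num) (x' - y)).hasFDerivAt.comp x'
      ((hasFDerivAt_id x').sub_const y)).const_smul (ψ y)

end CompactKernel

theorem integral_smul_clm_apply {α E F : Type*} [MeasurableSpace α] [NormedAddCommGroup E]
    [NormedSpace ℝ E] [NormedAddCommGroup F] [NormedSpace ℂ F] [NormedSpace ℝ F]
    [SMulCommClass ℝ ℂ F] {σ : Measure α} {ψ : α → ℂ}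
    {A : α → E →L[ℝ] F} (hi : Integrable (fun y => ψ y • A y) σ) (v : E) :
    Integrable (fun y => ψ y • A y v) σ ∧
      (∫ y, ψ y • A y ∂σ) v = ∫ y, ψ y • A y v ∂σ :=
  ⟨hi.apply_continuousLinearMap v, ContinuousLinearMap.integral_apply hi v⟩

theorem hasDerivAt_line {u : Plane → ℂ} {x v : Plane} {t : ℝ} {A : Plane →L[ℝ] ℂ}
    (h : HasFDerivAt u A (x + t • v)) : HasDerivAt (fun t : ℝ => u (x + t • v)) (A v) t := by
  have hl : HasDerivAt (fun t : ℝ => x + t • v) v t := by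
    simpa using ((hasDerivAt_id t).smul_const v).const_add x
  exact h.comp_hasDerivAt t hl

/-- The Laplacian as a sum of iterated directional derivatives. -/
theorem laplacian_eq_sum_fderiv_fderiv {u : Plane → ℂ} (hu : ContDiff ℝ 2 u) (x : Plane) :
    Laplacian.laplacian u x = ∑ i, fderiv ℝ (fun z => fderiv ℝ u z
      (EuclideanSpace.basisFun (Fin 2) ℝ i)) x (EuclideanSpace.basisFun (Fin 2) ℝ i) := by
  rw [laplacian_eq_sum_deriv_deriv hu.contDiffAt]
  refine Finset.sum_congr rfl fun i _ => ?_
  set v : Plane := EuclideanSpace.basisFun (Fin 2) ℝ i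
  have h1 : (deriv fun t : ℝ => u (x + t • v)) = fun t => fderiv ℝ u (x + t • v) v :=
    funext fun t => (hasDerivAt_line (hu.differentiable (by norm_num) _).hasFDerivAt).deriv
  have hd : ContDiff ℝ 1 fun z => fderiv ℝ u z v :=
    (hu.fderiv_right (by norm_num)).clm_apply contDiff_const
  have h2 := (hasDerivAt_line (x := x) (v := v) (t := 0)
    (hd.differentiable (by norm_num) _).hasFDerivAt).deriv
  rw [h1, h2]
  simp

theorem fderiv_integral_mul_sub_apply {σ : Measure Plane} {ψ g : Plane → ℂ}
    (hψ : Integrable ψ σ) (hg : ContDiff ℝ 1 g) (hcg : HasCompactSupport g) (x v : Plane) :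
    Integrable (fun y => ψ y * fderiv ℝ g (x - y) v) σ ∧
      fderiv ℝ (fun x => ∫ y, ψ y * g (x - y) ∂σ) x v =
        ∫ y, ψ y * fderiv ℝ g (x - y) v ∂σ := by
  have hi := integrable_smul_sub_of_hasCompactSupport hψ (hg.continuous_fderiv (by norm_num))
    (hcg.fderiv ℝ) x
  have h1 : fderiv ℝ (fun x => ∫ y, ψ y * g (x - y) ∂σ) x = ∫ y, ψ y • fderiv ℝ g (x - y) ∂σ :=
    (hasFDerivAt_integral_smul_sub hψ hg hcg x).fderiv
  have h2 := integral_smul_clm_apply hi v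
  exact ⟨h2.1, by rw [h1]; exact h2.2⟩

open scoped Convolution in
theorem contDiff_integral_mul_sub {σ : Measure Plane} {ψ g : Plane → ℂ}
    (hψ : Integrable ψ σ) (hg : ContDiff ℝ 2 g) (hcg : HasCompactSupport g) :
    ContDiff ℝ 2 fun x => ∫ y, ψ y * g (x - y) ∂σ :=
  hcg.contDiff_convolution_right (n := 2) (ContinuousLinearMap.mul ℝ ℂ) hψ.locallyIntegrable hg

theorem laplacian_integral_mul_sub {σ : Measure Plane} {ψ g : Plane → ℂ}
    (hψ : Integrable ψ σ) (hg : ContDiff ℝ 2 g) (hcg : HasCompactSupport g) (x : Plane) :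
    Laplacian.laplacian (fun x => ∫ y, ψ y * g (x - y) ∂σ) x =
      ∫ y, ψ y * Laplacian.laplacian g (x - y) ∂σ := by
  have hg1 : ∀ v, ContDiff ℝ 1 fun z => fderiv ℝ g z v := fun v =>
    (hg.fderiv_right (by norm_num)).clm_apply contDiff_const
  have hcg1 : ∀ v, HasCompactSupport fun z => fderiv ℝ g z v := fun v =>
    (hcg.fderiv ℝ).comp_left (g := fun A : Plane →L[ℝ] ℂ => A v) rfl
  have h1 : ∀ v, (fun z => fderiv ℝ (fun x => ∫ y, ψ y * g (x - y) ∂σ) z v) =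
      fun z => ∫ y, ψ y * fderiv ℝ g (z - y) v ∂σ := fun v =>
    funext fun z => (fderiv_integral_mul_sub_apply hψ (hg.of_le (by norm_num)) hcg z v).2
  have h2 := fun v => fderiv_integral_mul_sub_apply hψ (hg1 v) (hcg1 v) x v
  rw [laplacian_eq_sum_fderiv_fderiv (contDiff_integral_mul_sub hψ hg hcg)]
  simp only [laplacian_eq_sum_fderiv_fderiv hg, Finset.mul_sum, h1]
  rw [integral_finsetSum _ fun i _ => (h2 _).1]
  exact Finset.sum_congr rfl fun i _ => (h2 _).2

theorem exists_contDiff_eq_one_of_isCompact {K U : Set Plane} (hK : IsCompact K) (hU : IsOpen U)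
    (hKU : K ⊆ U) : ∃ χ : Plane → ℝ, ContDiff ℝ 2 χ ∧ (∀ x ∈ K, χ x = 1) ∧
      HasCompactSupport χ ∧ tsupport χ ⊆ U := by
  obtain ⟨δ, hδ, hδU⟩ := hK.exists_cthickening_subset_open hU hKU
  obtain ⟨f, hf0, hf1, -⟩ := exists_contMDiffMap_zero_one_of_isClosed (n := 2)
    (modelWithCornersSelf ℝ Plane) (s := (Metric.thickening δ K)ᶜ) (t := K)
    Metric.isOpen_thickening.isClosed_compl hK.isClosed
    (disjoint_compl_left_iff_subset.2 (Metric.self_subset_thickening hδ K))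
  have hsupp : tsupport f ⊆ Metric.cthickening δ K := by
    refine closure_minimal (fun x hx => ?_) Metric.isClosed_cthickening
    by_contra hcon
    exact hx (hf0 fun h => hcon (Metric.thickening_subset_cthickening δ K h))
  exact ⟨f, f.contMDiff.contDiff, fun x hx => hf1 hx,
    HasCompactSupport.of_support_subset_isCompact hK.cthickening
      ((subset_tsupport f).trans hsupp), hsupp.trans hδU⟩

/-- A potential with a kernel that solves the Helmholtz equation away from `Z` solves the
Helmholtz equation where the kernel is not singular. -/
theorem potential_helmholtz {σ : Measure Plane} {H ψ : Plane → ℂ} {Z K D : Set Plane} {κ : ℂ}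
    (hZ : IsClosed Z) (hH : ∀ z ∉ Z, ContDiffAt ℝ 2 H z)
    (hHZ : ∀ z ∉ Z, Laplacian.laplacian H z + κ * H z = 0)
    (hK : IsCompact K) (hσK : ∀ᵐ y ∂σ, y ∈ K) (hψ : Integrable ψ σ) (hD : IsOpen D)
    (hDK : ∀ x ∈ D, ∀ y ∈ K, x - y ∉ Z) {x : Plane} (hx : x ∈ D) :
    ContDiffAt ℝ 2 (fun x => ∫ y, ψ y * H (x - y) ∂σ) x ∧
      Laplacian.laplacian (fun x => ∫ y, ψ y * H (x - y) ∂σ) x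
        + κ * ∫ y, ψ y * H (x - y) ∂σ = 0 := by
  obtain ⟨r, hr, hrD⟩ := Metric.nhds_basis_closedBall.mem_iff.1 (hD.mem_nhds hx)
  -- The compact set of all differences met near x avoids the singular set Z, so a cutoff replaces H
  -- by a compactly supported C² kernel without changing the potential near x.
  set K' := (fun p : Plane × Plane => p.1 - p.2) '' (Metric.closedBall x r ×ˢ K) with hK'
  have hK'c : IsCompact K' := ((isCompact_closedBall x r).prod hK).image
    (continuous_fst.sub continuous_snd)
  have hK'Z : K' ⊆ Zᶜ := by
    rintro _ ⟨p, hp, rfl⟩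
    exact hDK p.1 (hrD hp.1) p.2 hp.2
  obtain ⟨χ, hχ, hχ1, hχc, hχs⟩ := exists_contDiff_eq_one_of_isCompact hK'c hZ.isOpen_compl hK'Z
  set g : Plane → ℂ := fun z => (χ z : ℂ) * H z with hg
  have hgsupp : tsupport g ⊆ tsupport χ := by
    refine closure_mono fun z hz hz' => hz ?_
    simp [hg, hz']
  have hgc : HasCompactSupport g := hχc.of_isClosed_subset (isClosed_tsupport g) hgsupp
  have hgd : ContDiff ℝ 2 g := by
    refine contDiff_iff_contDiffAt.2 fun z => ?_
    by_cases hz : z ∈ tsupport g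
    swap
    · exact contDiffAt_const.congr_of_eventuallyEq (notMem_tsupport_iff_eventuallyEq.1 hz)
    exact (Complex.ofRealCLM.contDiff.comp hχ).contDiffAt.mul (hH z (hχs (hgsupp hz)))
  have heq : ∀ x' ∈ Metric.closedBall x r,
      ∫ y, ψ y * H (x' - y) ∂σ = ∫ y, ψ y * g (x' - y) ∂σ := by
    intro x' hx'
    refine integral_congr_ae ?_
    filter_upwards [hσK] with y hy
    have : χ (x' - y) = 1 := hχ1 _ ⟨(x', y), ⟨hx', hy⟩, rfl⟩
    simp [hg, this]
  have hev : (fun x => ∫ y, ψ y * H (x - y) ∂σ) =ᶠ[𝓝 x] fun x => ∫ y, ψ y * g (x - y) ∂σ := by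
    filter_upwards [Metric.closedBall_mem_nhds x hr] with x' hx'
    exact heq x' hx'
  have hlap : ∀ᵐ y ∂σ, ψ y * Laplacian.laplacian g (x - y) = -κ * (ψ y * H (x - y)) := by
    filter_upwards [hσK] with y hy
    have hgH : g =ᶠ[𝓝 (x - y)] H := by
      filter_upwards [Metric.closedBall_mem_nhds (x - y) hr] with z hz
      have : χ z = 1 := by
        refine hχ1 _ ⟨(z + y, y), ⟨?_, hy⟩, by simp⟩
        simpa [Metric.mem_closedBall, dist_eq_norm, sub_sub_eq_add_sub] using hz
      simp [hg, this]
    rw [(InnerProductSpace.laplacian_congr_nhds hgH).self_of_nhds]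
    linear_combination ψ y * hHZ (x - y) (hDK x hx y hy)
  refine ⟨(contDiff_integral_mul_sub hψ hgd hgc).contDiffAt.congr_of_eventuallyEq hev, ?_⟩
  rw [(InnerProductSpace.laplacian_congr_nhds hev).self_of_nhds,
    laplacian_integral_mul_sub hψ hgd hgc, integral_congr_ae hlap, integral_const_mul]
  ring

/-! ### The maximum principle -/

/-- At a local maximum the positive second derivative would force a local minimum too, hence a
locally constant function, whose second derivative is 0. -/
theorem not_isLocalMax_of_deriv_deriv_pos {h : ℝ → ℝ} {t : ℝ} (hc : ContinuousAt h t)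
    (hpos : 0 < deriv (deriv h) t) : ¬IsLocalMax h t := by
  intro hmax
  have hmin := isLocalMin_of_deriv_deriv_pos hpos hmax.deriv_eq_zero hc
  have heq : h =ᶠ[𝓝 t] fun _ => h t := by
    filter_upwards [hmax, hmin] with s h1 h2
    exact le_antisymm h1 h2
  have h1 : deriv h =ᶠ[𝓝 t] fun _ => 0 := by
    simpa using heq.deriv
  rw [h1.deriv_eq] at hpos
  simp at hpos

theorem deriv_deriv_re_add_mul_norm_sq {w : Plane → ℂ} {x : Plane} (hw : ContDiffAt ℝ 2 w x)
    {v : Plane} (hv : ‖v‖ = 1) (ε : ℝ) :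
    deriv (deriv fun t : ℝ => (w (x + t • v)).re + ε * ‖x + t • v‖ ^ 2) 0 =
      (deriv (deriv fun t : ℝ => w (x + t • v)) 0).re + 2 * ε := by
  have hW := hw.comp_line v
  set W : ℝ → ℂ := fun t => w (x + t • v) with hWdef
  have hn : ∀ t : ℝ, ‖x + t • v‖ ^ 2 = ‖x‖ ^ 2 + 2 * ⟪x, v⟫_ℝ * t + t ^ 2 := by
    intro t
    rw [norm_add_sq_real, norm_smul, hv, inner_smul_right, mul_one, Real.norm_eq_abs, sq_abs]
    ring
  have hre : ∀ {f : ℝ → ℂ} {f' : ℂ} {t : ℝ}, HasDerivAt f f' t →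
      HasDerivAt (fun t => (f t).re) f'.re t := fun h =>
    Complex.reCLM.hasFDerivAt.comp_hasDerivAt _ h
  have h1 : ∀ᶠ t in 𝓝 (0 : ℝ),
      deriv (fun t : ℝ => (w (x + t • v)).re + ε * ‖x + t • v‖ ^ 2) t =
        (deriv W t).re + ε * (2 * ⟪x, v⟫_ℝ + 2 * t) := by
    filter_upwards [hW.eventually (by simp)] with t ht
    simp only [hn]
    have h2 := hre (ht.differentiableAt (by norm_num)).hasDerivAt
    have h3 : HasDerivAt (fun t : ℝ => ‖x‖ ^ 2 + 2 * ⟪x, v⟫_ℝ * t + t ^ 2)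
        (2 * ⟪x, v⟫_ℝ + 2 * t) t := by
      have := (((hasDerivAt_id t).const_mul (2 * ⟪x, v⟫_ℝ)).const_add (‖x‖ ^ 2)).add
        ((hasDerivAt_id t).pow 2)
      exact this.congr_deriv (by simp)
    exact (h2.add (h3.const_mul ε)).deriv
  have h4 : HasDerivAt (deriv W) (deriv (deriv W) 0) 0 := by
    have h := (hW.fderiv_right (m := 1) (by norm_num)).clm_apply
      (contDiffAt_const (c := (1 : ℝ)))
    exact (h.differentiableAt (by norm_num)).hasDerivAt
  have h5 : HasDerivAt (fun t : ℝ => ε * (2 * ⟪x, v⟫_ℝ + 2 * t)) (ε * 2) 0 := by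
    simpa using (((hasDerivAt_id (0 : ℝ)).const_mul 2).const_add (2 * ⟪x, v⟫_ℝ)).const_mul ε
  refine (EventuallyEq.deriv_eq h1).trans (((hre h4).add h5).deriv.trans ?_)
  ring

/-- The weak maximum principle for harmonic functions. -/
theorem re_le_zero_of_laplacian_eq_zero {D : Set Plane} (hD : IsOpen D)
    (hDc : IsCompact (closure D)) {w : Plane → ℂ} (hw : ∀ x ∈ D, ContDiffAt ℝ 2 w x)
    (hwc : ContinuousOn w (closure D)) (hlap : ∀ x ∈ D, Laplacian.laplacian w x = 0)
    (hbd : ∀ x ∈ frontier D, w x = 0) {x : Plane} (hx : x ∈ D) : (w x).re ≤ 0 := by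
  obtain ⟨B, hB⟩ := hDc.isBounded.exists_norm_le
  -- Adding ε|y|² makes the Laplacian strictly positive, which excludes an interior maximum. On the
  -- boundary the function is at most εB².
  have key : ∀ ε > 0, (w x).re ≤ ε * B ^ 2 := by
    intro ε hε
    have hcont : ContinuousOn (fun y => (w y).re + ε * ‖y‖ ^ 2) (closure D) :=
      (Complex.continuous_re.comp_continuousOn hwc).add
        (continuous_const.mul (continuous_norm.pow 2)).continuousOn
    obtain ⟨z, hz, hzmax⟩ := hDc.exists_isMaxOn ⟨x, subset_closure hx⟩ hcont
    have h1 : (w x).re + ε * ‖x‖ ^ 2 ≤ (w z).re + ε * ‖z‖ ^ 2 := hzmax (subset_closure hx)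
    by_cases hzD : z ∈ D
    · exfalso
      have hmax : ∀ v : Plane, IsLocalMax (fun t : ℝ => (w (z + t • v)).re +
          ε * ‖z + t • v‖ ^ 2) 0 := by
        intro v
        have hl : Tendsto (fun t : ℝ => z + t • v) (𝓝 0) (𝓝 z) := by
          have : Continuous fun t : ℝ => z + t • v :=
            continuous_const.add (continuous_id.smul continuous_const)
          simpa using this.tendsto 0
        filter_upwards [hl.eventually (hD.mem_nhds hzD)] with t ht
        simpa using hzmax (subset_closure ht)
      have hsum := hlap z hzD
      rw [laplacian_eq_sum_deriv_deriv (hw z hzD), Fin.sum_univ_two] at hsum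
      have hneg : ∀ i, (deriv (deriv fun t : ℝ =>
          w (z + t • EuclideanSpace.basisFun (Fin 2) ℝ i)) 0).re + 2 * ε ≤ 0 := by
        intro i
        by_contra hcon
        rw [not_le, ← deriv_deriv_re_add_mul_norm_sq (hw z hzD) (by simp)] at hcon
        refine not_isLocalMax_of_deriv_deriv_pos ?_ hcon (hmax _)
        have hl : ContinuousAt (fun t : ℝ => z + t • EuclideanSpace.basisFun (Fin 2) ℝ i) 0 :=
          (continuous_const.add (continuous_id.smul continuous_const)).continuousAt
        exact (Complex.continuous_re.continuousAt.comp
          ((hw z hzD).comp_line _).continuousAt).add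
          (continuousAt_const.mul (hl.norm.pow 2))
      have h0 := congrArg Complex.re hsum
      simp only [Complex.add_re, Complex.zero_re] at h0
      linarith [hneg 0, hneg 1]
    · have hzf : z ∈ frontier D := by
        rw [hD.frontier_eq]
        exact ⟨hz, hzD⟩
      rw [hbd z hzf, Complex.zero_re, zero_add] at h1
      have h2 : ‖z‖ ^ 2 ≤ B ^ 2 := pow_le_pow_left₀ (norm_nonneg z) (hB z hz) 2
      have h3 : 0 ≤ ε * ‖x‖ ^ 2 := by positivity
      nlinarith
  refine le_of_forall_pos_le_add fun δ hδ => ?_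
  have h1 := key (δ / (B ^ 2 + 1)) (by positivity)
  refine h1.trans ?_
  rw [zero_add, div_mul_eq_mul_div, div_le_iff₀ (by positivity)]
  nlinarith

/-- Multiplying w by the conjugate of its value at x makes the real part at x equal to |w(x)|². -/
theorem eq_zero_of_laplacian_eq_zero {D : Set Plane} (hD : IsOpen D)
    (hDc : IsCompact (closure D)) {w : Plane → ℂ} (hw : ∀ x ∈ D, ContDiffAt ℝ 2 w x)
    (hwc : ContinuousOn w (closure D)) (hlap : ∀ x ∈ D, Laplacian.laplacian w x = 0)
    (hbd : ∀ x ∈ frontier D, w x = 0) {x : Plane} (hx : x ∈ D) : w x = 0 := by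
  set c : ℂ := starRingEnd ℂ (w x)
  have h := re_le_zero_of_laplacian_eq_zero hD hDc (w := c • w)
    (fun y hy => (hw y hy).const_smul c) (hwc.const_smul c)
    (fun y hy => by
      rw [InnerProductSpace.laplacian_smul _ (hw y hy), hlap y hy, smul_zero])
    (fun y hy => by rw [Pi.smul_apply, hbd y hy, smul_zero]) hx
  have h1 : ((c • w) x).re = Complex.normSq (w x) := by
    rw [Pi.smul_apply, smul_eq_mul, ← Complex.normSq_eq_conj_mul_self, Complex.ofReal_re]
  rw [h1] at h
  exact Complex.normSq_eq_zero.1 (le_antisymm h (Complex.normSq_nonneg _))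

/-! ### Geometry of the resonators -/

section Geometry

variable {l : Module.Basis (Fin 2) ℝ Plane}

theorem isCompact_unitCell : IsCompact (unitCell l) := by
  unfold unitCell parallelepiped
  refine isCompact_Icc.image ?_
  exact continuous_finsetSum _ fun i _ => (continuous_apply i).smul continuous_const

theorem repr_mem_Icc_of_mem_unitCell {x : Plane} (hx : x ∈ unitCell l) (i : Fin 2) :
    l.repr x i ∈ Icc (0 : ℝ) 1 := by
  obtain ⟨t, ht, rfl⟩ := (mem_parallelepiped_iff _ _).1 hx
  have : l.repr (∑ i, t i • l i) i = t i := by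
    rw [map_sum]
    fin_cases i <;> simp
  rw [this]
  exact ⟨ht.1 i, ht.2 i⟩

theorem repr_mem_Ioo_of_mem_isOpen {D : Set Plane} (hD : IsOpen D) (hDY : D ⊆ unitCell l)
    {x : Plane} (hx : x ∈ D) (i : Fin 2) : l.repr x i ∈ Ioo (0 : ℝ) 1 := by
  have hc : Continuous fun t : ℝ => x + t • l i :=
    continuous_const.add (continuous_id.smul continuous_const)
  have hev : ∀ᶠ t : ℝ in 𝓝 0, x + t • l i ∈ D := by
    have := hc.tendsto 0
    rw [zero_smul, add_zero] at this
    exact this.eventually (hD.mem_nhds hx)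
  obtain ⟨ε, hε, hball⟩ := Metric.eventually_nhds_iff_ball.1 hev
  have h : ∀ t : ℝ, |t| < ε → l.repr x i + t ∈ Icc (0 : ℝ) 1 := by
    intro t ht
    have := repr_mem_Icc_of_mem_unitCell (hDY (hball t (by simpa using ht))) i
    simpa using this
  have h1 := h (ε / 2) (by rw [abs_of_pos (by positivity)]; linarith)
  have h2 := h (-(ε / 2)) (by rw [abs_neg, abs_of_pos (by positivity)]; linarith)
  exact ⟨by linarith [h2.1], by linarith [h1.2]⟩

/-- Points of D have coordinates strictly between 0 and 1 and boundary points lie in the closed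
cell, so integer differences must be 0. Thus the kernel is regular in D even if the boundary touches
opposite sides of the cell. -/
theorem sub_notMem_latticeSingular {D : Set Plane} (hD : IsOpen D) (hDY : D ⊆ unitCell l)
    {x y : Plane} (hx : x ∈ D) (hy : y ∈ frontier D) : x - y ∉ latticeSingular l := by
  intro hcon
  have hyY : y ∈ unitCell l := closure_minimal hDY isCompact_unitCell.isClosed hy.1
  have hxy : x = y := by
    refine l.ext_elem fun i => ?_
    obtain ⟨n, hn⟩ := (planeWave_reciprocalVector_eq_one_iff i _).1 (hcon i)
    have h1 := repr_mem_Ioo_of_mem_isOpen hD hDY hx i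
    have h2 := repr_mem_Icc_of_mem_unitCell hyY i
    rw [map_sub, Finsupp.sub_apply] at hn
    have h3 : (n : ℝ) < 1 := by linarith [h1.2, h2.1]
    have h4 : (-1 : ℝ) < n := by linarith [h1.1, h2.2]
    have h5 : n = 0 := by
      have h3' : n < 1 := by exact_mod_cast h3
      have h4' : -1 < n := by exact_mod_cast h4
      omega
    rw [h5, Int.cast_zero] at hn
    linarith
  rw [hD.frontier_eq] at hy
  exact hy.2 (hxy ▸ hx)

theorem ae_sub_notMem_latticeSingular (D : Set Plane) (x : Plane) :
    ∀ᵐ y ∂(boundaryMeasure D), x - y ∉ latticeSingular l := by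
  refine ae_restrict_of_ae ?_
  have := Measure.nullSingletonClass_hausdorff Plane one_pos
  have hc : {y : Plane | x - y ∈ latticeSingular l}.Countable :=
    countable_latticeSingular.preimage_of_injOn (f := fun y : Plane => x - y)
      (sub_right_injective.injOn)
  simpa [ae_iff] using hc.measure_zero (Measure.hausdorffMeasure 1)

/-- A boundary point of one resonator cannot lie in another: being open, the second would meet the
first. -/
theorem IsResonatorFamily.frontier_iUnion {s : ℝ≥0} {N : ℕ} {R : Fin N → Set Plane}
    (hR : IsResonatorFamily l s R) : frontier (⋃ i, R i) = ⋃ i, frontier (R i) := by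
  rw [(isOpen_iUnion hR.isOpen).frontier_eq, closure_iUnion_of_finite]
  ext y
  simp only [Set.mem_sdiff, mem_iUnion, not_exists]
  constructor
  · rintro ⟨⟨i, hi⟩, hy⟩
    refine ⟨i, ?_⟩
    rw [(hR.isOpen i).frontier_eq]
    exact ⟨hi, hy i⟩
  · rintro ⟨i, hi⟩
    rw [(hR.isOpen i).frontier_eq] at hi
    refine ⟨⟨i, hi.1⟩, fun j hj => ?_⟩
    rcases eq_or_ne i j with rfl | hij
    · exact hi.2 hj
    · obtain ⟨z, hz, hz'⟩ := mem_closure_iff.1 hi.1 (R j) (hR.isOpen j) hj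
      exact (hR.disjoint hij).ne_of_mem hz' hz rfl

end Geometry

/-! ### The single layer potential -/

section SingleLayer

variable {l : Module.Basis (Fin 2) ℝ Plane} {α β : Plane} {k : ℝ} {D : Set Plane}

/-- For x and y in the closed cell the lattice coordinates of x - y lie in [-1, 1], so only nine
lattice points can be nearest. The cube is at most a sum of nine translated Riesz kernels. -/
theorem lintegral_bandGapGreen_pow_three_le
    (h : ∀ p, bandGapSymbol β k (latticeFreq l α p) ≠ 0) (hDY : D ⊆ unitCell l)
    (hP : HasBoundedPotential (frontier D)) :
    ∃ M : ENNReal, M < ⊤ ∧ ∀ x ∈ closure D,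
      ∫⁻ y, ‖bandGapGreen l α β k (x - y)‖ₑ ^ 3 ∂(boundaryMeasure D) ≤ M := by
  obtain ⟨C, hC0, hC⟩ := exists_norm_bandGapGreen_le (l := l) (α := α) (β := β) (k := k) h
  obtain ⟨-, A, hA, hAx⟩ := hP
  have hYc : closure D ⊆ unitCell l := closure_minimal hDY isCompact_unitCell.isClosed
  set I : Finset (Fin 2 → ℤ) := Fintype.piFinset fun _ => Finset.Icc (-1) 1 with hI
  refine ⟨ENNReal.ofReal C ^ 3 * ∑ _m ∈ I, A, ?_, fun x hx => ?_⟩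
  · rw [Finset.sum_const, nsmul_eq_mul]
    exact ENNReal.mul_lt_top (ENNReal.pow_lt_top ENNReal.ofReal_lt_top)
      (ENNReal.mul_lt_top (ENNReal.natCast_lt_top _) hA)
  have hpt : ∀ᵐ y ∂(boundaryMeasure D), ‖bandGapGreen l α β k (x - y)‖ₑ ^ 3 ≤
      ENNReal.ofReal C ^ 3 *
        ∑ m ∈ I, edist (x - ∑ i, (m i : ℝ) • l i) y ^ (-(3 / 4) : ℝ) := by
    have hfr : ∀ᵐ y ∂(boundaryMeasure D), y ∈ frontier D :=
      ae_restrict_mem isClosed_frontier.measurableSet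
    filter_upwards [ae_sub_notMem_latticeSingular (l := l) D x, hfr] with y hy hyf
    set m : Fin 2 → ℤ := fun i => round (l.repr (x - y) i) with hm
    have hmI : m ∈ I := by
      rw [hI, Fintype.mem_piFinset]
      intro i
      have h1 := repr_mem_Icc_of_mem_unitCell (hYc hx) i
      have h2 := repr_mem_Icc_of_mem_unitCell (hYc hyf.1) i
      have h3 := abs_le.1 (abs_sub_round (l.repr (x - y) i))
      have h4 : l.repr (x - y) i = l.repr x i - l.repr y i := by simp
      have h5 : (m i : ℝ) < 2 := by
        have : (m i : ℝ) = round (l.repr (x - y) i) := rfl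
        linarith [h3.1, h1.2, h2.1]
      have h6 : (-2 : ℝ) < m i := by
        have : (m i : ℝ) = round (l.repr (x - y) i) := rfl
        linarith [h3.2, h1.1, h2.2]
      have h5' : m i < 2 := by exact_mod_cast h5
      have h6' : -2 < m i := by exact_mod_cast h6
      rw [Finset.mem_Icc]
      omega
    set ℓ : Plane := ∑ i, (m i : ℝ) • l i with hℓ
    have hG : ‖bandGapGreen l α β k (x - y)‖ ≤ C * ‖x - y - ℓ‖ ^ (-(1 / 4) : ℝ) := hC _ hy
    have hG' : ‖bandGapGreen l α β k (x - y)‖ₑ ≤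
        ENNReal.ofReal C * edist (x - ℓ) y ^ (-(1 / 4) : ℝ) := by
      rw [edist_eq_enorm_sub, sub_right_comm]
      -- At a zero the extended power is ∞ and the bound is trivial, whereas the real power would
      -- default to 0.
      rcases eq_or_ne (x - y - ℓ) 0 with h0 | h0
      · rw [h0, enorm_zero, ENNReal.zero_rpow_of_neg (by norm_num),
          ENNReal.mul_top (by simpa using hC0)]
        exact le_top
      · rw [← ofReal_norm, ← ofReal_norm (x - y - ℓ),
          ENNReal.ofReal_rpow_of_pos (norm_pos_iff.2 h0), ← ENNReal.ofReal_mul hC0.le]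
        exact ENNReal.ofReal_le_ofReal hG
    calc ‖bandGapGreen l α β k (x - y)‖ₑ ^ 3
        ≤ (ENNReal.ofReal C * edist (x - ℓ) y ^ (-(1 / 4) : ℝ)) ^ 3 := by gcongr
      _ = ENNReal.ofReal C ^ 3 * edist (x - ℓ) y ^ (-(3 / 4) : ℝ) := by
          rw [mul_pow, ← ENNReal.rpow_natCast (_ ^ _ : ENNReal), ← ENNReal.rpow_mul]
          norm_num
      _ ≤ _ := by
          gcongr
          exact Finset.single_le_sum
            (f := fun m : Fin 2 → ℤ => edist (x - ∑ i, (m i : ℝ) • l i) y ^ (-(3 / 4) : ℝ))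
            (fun _ _ => zero_le) hmI
  have hmeas : ∀ z : Plane, Measurable fun y => edist z y ^ (-(3 / 4) : ℝ) := fun z =>
    (measurable_const.edist measurable_id).pow_const _
  calc ∫⁻ y, ‖bandGapGreen l α β k (x - y)‖ₑ ^ 3 ∂(boundaryMeasure D)
      ≤ ∫⁻ y, ENNReal.ofReal C ^ 3 *
        ∑ m ∈ I, edist (x - ∑ i, (m i : ℝ) • l i) y ^ (-(3 / 4) : ℝ) ∂(boundaryMeasure D) :=
        lintegral_mono_ae hpt
    _ = ENNReal.ofReal C ^ 3 * ∑ m ∈ I, ∫⁻ y,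
        edist (x - ∑ i, (m i : ℝ) • l i) y ^ (-(3 / 4) : ℝ) ∂(boundaryMeasure D) := by
        rw [lintegral_const_mul _ (Finset.measurable_fun_sum _ fun m _ => hmeas _),
          lintegral_finsetSum _ fun m _ => hmeas _]
    _ ≤ _ := by
        gcongr with m
        exact hAx _

/-- The conjugated single layer potential solves the Helmholtz equation in `D`. -/
theorem expWeight_mul_singleLayer_helmholtz
    (h : ∀ p, bandGapSymbol β k (latticeFreq l α p) ≠ 0) (hD : IsOpen D) (hDY : D ⊆ unitCell l)
    (hf : IsFiniteMeasure (boundaryMeasure D)) (φ : Lp ℂ 2 (boundaryMeasure D)) {x : Plane}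
    (hx : x ∈ D) :
    ContDiffAt ℝ 2 (fun x => expWeight β x * singleLayer l α β k D φ x) x ∧
      Laplacian.laplacian (fun x => expWeight β x * singleLayer l α β k D φ x) x
        + (k : ℂ) ^ 2 * (expWeight β x * singleLayer l α β k D φ x) = 0 := by
  have hKc : IsCompact (frontier D) :=
    isCompact_unitCell.of_isClosed_subset isClosed_frontier
      (frontier_subset_closure.trans (closure_minimal hDY isCompact_unitCell.isClosed))
  have hfr : ∀ᵐ y ∂(boundaryMeasure D), y ∈ frontier D :=
    ae_restrict_mem isClosed_frontier.measurableSet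
  have hφ : Integrable φ (boundaryMeasure D) := (Lp.memLp φ).integrable (by norm_num)
  have hψ : Integrable (fun y => expWeight β y * φ y) (boundaryMeasure D) := by
    have hc : Continuous (expWeight β) := (contDiff_expWeight (n := 0) β).continuous
    obtain ⟨B, hB⟩ := hKc.exists_bound_of_continuousOn hc.continuousOn
    refine (hφ.norm.const_mul B).mono' (hc.aestronglyMeasurable.mul hφ.1) ?_
    filter_upwards [hfr] with y hy
    rw [norm_mul]
    gcongr
    exact hB y hy
  -- The weight splits as exp(-β·(x - y)) exp(-β·y): one factor conjugates the kernel, the other is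
  -- absorbed into the density.
  have heq : (fun x => expWeight β x * singleLayer l α β k D φ x) = fun x =>
      ∫ y, (expWeight β y * φ y) * (expWeight β (x - y) * bandGapGreen l α β k (x - y))
        ∂(boundaryMeasure D) := by
    funext x
    rw [singleLayer, ← integral_const_mul]
    refine integral_congr_ae (Eventually.of_forall fun y => ?_)
    have := expWeight_add β (x - y) y
    rw [sub_add_cancel] at this
    simp only [this]
    ring
  have hval := congrFun heq x
  beta_reduce at hval
  rw [hval, heq]
  exact potential_helmholtz (H := fun z => expWeight β z * bandGapGreen l α β k z)
    isClosed_latticeSingular (fun z hz => contDiffAt_expWeight_mul_bandGapGreen h hz)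
    (fun z hz => laplacian_expWeight_mul_bandGapGreen h hz) hKc hfr hψ hD
    (fun x hx y hy => sub_notMem_latticeSingular hD hDY hx hy) hx

end SingleLayer

end

/-! ### Boundary values and uniqueness for the Dirichlet problem -/

theorem mainTheorem6 (l : Module.Basis (Fin 2) ℝ Plane) (s : ℝ≥0) (hs₀ : 0 < s) (hs₁ : s < 1)
    {N : ℕ} (R : Fin N → Set Plane) (hR : IsResonatorFamily l s R)
    (D : Set Plane) (hD : D = ⋃ i, R i)
    (α β : Plane) (k : ℝ)
    (hdenom : ∀ q ∈ reciprocalLattice l, bandGapSymbol β k (α + q) ≠ 0)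
    (hk : k ≠ 0 → ¬ IsDirichletEigenvalue D (k ^ 2))
    (φ : Lp ℂ 2 (boundaryMeasure D))
    (hφ : IsNontrivialKernelFunction l α β k D φ) :
    ∀ x ∈ D, singleLayer l α β k D φ x = 0 := by
  have h : ∀ p, bandGapSymbol β k (latticeFreq l α p) ≠ 0 := fun p =>
    hdenom _ ((mem_reciprocalLattice_iff l _).2 ⟨p.1, p.2, rfl⟩)
  have hDo : IsOpen D := hD ▸ isOpen_iUnion hR.isOpen
  have hDY : D ⊆ unitCell l := hD ▸ iUnion_subset hR.subset_unitCell
  have hDc : IsCompact (closure D) := isCompact_unitCell.of_isClosed_subset isClosed_closure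
    (closure_minimal hDY isCompact_unitCell.isClosed)
  have hfront : frontier D = ⋃ i, frontier (R i) := hD ▸ hR.frontier_iUnion
  have hfc : ∀ i, IsCompact (frontier (R i)) := fun i =>
    isCompact_unitCell.of_isClosed_subset isClosed_frontier
      (frontier_subset_closure.trans
        (closure_minimal (hR.subset_unitCell i) isCompact_unitCell.isClosed))
  have hP : HasBoundedPotential (frontier D) :=
    hfront ▸ HasBoundedPotential.iUnion fun i => (hR.boundary i).hasBoundedPotential (hfc i)
  have hfin : IsFiniteMeasure (boundaryMeasure D) :=
    ⟨by rw [boundaryMeasure, Measure.restrict_apply_univ]; exact hP.1⟩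
  obtain ⟨M, hM, hMx⟩ := lintegral_bandGapGreen_pow_three_le h hDY hP
  have hcont : ContinuousOn (singleLayer l α β k D φ) (closure D) :=
    continuousOn_potential isClosed_latticeSingular
      (fun z hz => (contDiffAt_bandGapGreen h hz).continuousAt.continuousWithinAt)
      (ae_sub_notMem_latticeSingular D) hM hMx (Lp.memLp φ)
  -- By continuity a nonzero value would persist on a piece of boundary of positive length, against
  -- vanishing almost everywhere.
  have hbd : ∀ p ∈ frontier D, singleLayer l α β k D φ p = 0 := by
    intro p hp
    by_contra hne
    have hev := (hcont p hp.1).eventually_ne hne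
    obtain ⟨U, hU, hUD⟩ := mem_nhdsWithin_iff_exists_mem_nhds_inter.1 hev
    obtain ⟨i, hi⟩ := mem_iUnion.1 (hfront ▸ hp)
    have hpos := (hR.boundary i).hausdorffMeasure_pos (hR.isOpen i) hi hU
    have hzero := hφ.2
    rw [ae_iff, boundaryMeasure, Measure.restrict_apply' isClosed_frontier.measurableSet] at hzero
    refine hpos.ne' (measure_mono_null (fun y hy => ?_) hzero)
    have hyD : y ∈ frontier D := hfront ▸ mem_iUnion.2 ⟨i, hy.1⟩
    exact ⟨hUD ⟨hy.2, hyD.1⟩, hyD⟩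
  have hhelm := fun x hx => expWeight_mul_singleLayer_helmholtz h hDo hDY hfin φ (x := x) hx
  set w : Plane → ℂ := fun x => expWeight β x * singleLayer l α β k D φ x with hw
  have hwc : ContinuousOn w (closure D) :=
    (contDiff_expWeight (n := 0) β).continuous.continuousOn.mul hcont
  have hwb : ∀ x ∈ frontier D, w x = 0 := fun x hx => by
    simp only [hw, hbd x hx, mul_zero]
  have hw0 : ∀ x ∈ D, w x = 0 := by
    -- For k = 0 the function w is harmonic. Otherwise a nonzero value of w would make it an
    -- eigenfunction for k².
    by_cases hk0 : k = 0
    · intro x hx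
      refine eq_zero_of_laplacian_eq_zero hDo hDc (fun x hx => (hhelm x hx).1) hwc
        (fun x hx => ?_) hwb hx
      simpa [hk0] using (hhelm x hx).2
    · intro x hx
      by_contra hne
      refine hk hk0 ⟨w, fun x hx => (hhelm x hx).1.contDiffWithinAt, hwc, fun x hx => ?_, hwb,
        x, hx, hne⟩
      have := (hhelm x hx).2
      simpa [hw] using this
  intro x hx
  exact (mul_eq_zero.1 (hw0 x hx)).resolve_left (expWeight_ne_zero β x)
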